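/- Consider a pentapod with linear platform: real platform anchor points $m_i=(a_i,0,0)$ on the moving line $p$ and base anchor points $M_i\in\mathbb R^3$, $i=1,\dots,5$. Assume that it is not architecturally singular (in some pose its Jacobian, formed by the Plücker coordinates of the five leg lines, has rank 5), that no three $m_i$ coincide, that if two $m_i$ coincide then the other three base points are not collinear, that no four $M_i$ are collinear, that the $M_i$ are not coplanar, and that there is no affine map with $M_i\mapsto m_i$ for all $i$. A leg with anchor points $m,M$ (in homogeneous coordinates, ideal points allowed) is a *leg-replacement* if $m M^T$ lies in the linear span of the five $2\times4$ matrices $m_iM_i^T$. Suppose that the pentapod is of *Type 2*: the locus of the base points of leg-replacements splits into an irreducible conic $q$ in a finite plane $\varepsilon$ and a finite line $g_1\not\subset\varepsilon$ meeting $q$ in a point $Q$; the correspondence of anchor points is a bijection between $p\setminus\{P_1\}$ and $q\setminus\{Q\}$, and maps a finite point $P_1$ to $g_1$. Suppose also that it satisfies the *Duporcq condition*: $q$ is a circle and $g_1$ is orthogonal to its plane. Theorem. (1) There are Cartesian frames, numbers $a_2\in\mathbb C\setminus\mathbb R$, $a_3=\overline{a_2}$, and $(A_5,B_5)\in\mathbb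 R^2\setminus\{0\}$ such that the five legs with platform points $0,\ a_2,\ a_3,\ 0,\ \infty$ and base points: the origin, the ideal points in directions $(1,-i,0)$, $(1,i,0)$, $(0,0,1)$, and $(A_5,B_5,0)$, respectively, are (complex) leg-replacements. They impose, on the homogeneous motion parameters $(n_0:x_0:\dots:x_3:y_0:\dots:y_3)$, the conditions $$-\tfrac12R_1^2x_0+4n_0=0,\quad p_2x_0+a_2(x_1-ix_2)+y_1-iy_2=0,\quad p_3x_0+a_3(x_1+ix_2)+y_1+iy_2=0,$$ $$p_4x_0+y_3=0,\quad p_5x_0+A_5x_1+B_5x_2+y_0=0$$ with leg parameters $R_1,p_2,\dots,p_5\in\mathbb C$. (2) Let any such frames and numbers be given. For every choice of the leg parameters there are leg lengths $R^{(1)},\dots,R^{(5)}\in\mathbb C$ of the given pentapod whose five sphere conditions $$\tfrac12(a_j^2+A_j^2+B_j^2+C_j^2-(R^{(j)})^2)x_0+a_jA_jx_1+a_jB_jx_2+a_jC_jx_3+a_jy_0+A_jy_1+B_jy_2+C_jy_3+4n_0=0$$ (where here $a_j$ and $(A_j,B_j,C_j)$ denote the coordinates of the $j$-th original anchor points in these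 frames) are equivalent, as a linear system, to the five conditions in (1); and conversely all leg lengths arise from some leg parameters. Consider the equations $$p_2=-\frac{a_2(A_5-iB_5)}{a_3},\quad p_3=-\frac{a_3(A_5+iB_5)}{a_2},\quad p_4=0,\quad (A_5^2+B_5^2)(a_2+a_3)+2a_2a_3p_5-R_1^2(a_2+a_3)=0.\qquad(*)$$ For every $R_1\in\mathbb C$ there is exactly one choice of $p_2,\dots,p_5$ satisfying $(*)$, so the solutions of $(*)$ form a one-parameter family. For corresponding leg lengths and leg parameters, let $\mathcal C$ be the complex configuration set, i.e. the set of solutions with $x_0=1$ of the sphere conditions together with $x_1^2+x_2^2+x_3^2=x_0^2$, $y_1^2+y_2^2+y_3^2=8x_0n_0$, $x_1y_1+x_2y_2+x_3y_3=x_0y_0$. If $(*)$ holds, then $\mathcal C$ has dimension exactly 1, i.e. the pentapod has a self-motion over $\mathbb C$. Conversely, if $\mathcal C$ has positive dimension and $R_1\ne0$ or $p_3=\overline{p_2}$, then $(*)$ holds. -/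

import Mathlib

open MvPolynomial Matrix

noncomputable section

/-- Euclidean 3-space (the base space, with respect to the fixed frame). -/
abbrev E3 := EuclideanSpace ℝ (Fin 3)

/-- Homogeneous coordinates `(1 : x : y : z)` of a finite point of the base space. -/
def homog (X : E3) : Fin 4 → ℝ := ![1, X 0, X 1, X 2]

/-- Homogeneous coordinates `(0 : u : v : w)` of the ideal point in direction `(u, v, w)`. -/
def idealDir (n : E3) : Fin 4 → ℝ := ![0, n 0, n 1, n 2]

theorem homog_ne_zero (X : E3) : homog X ≠ 0 := fun h => by
  have := congrFun h 0
  simp [homog] at this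

theorem platPoint_ne_zero (a : ℝ) : (![1, a] : Fin 2 → ℝ) ≠ 0 := fun h => by
  have := congrFun h 0
  simp at this

/-- The projective closure of the platform line: `(1 : a)` is the finite point with
coordinate `a`, and `(0 : 1)` is the ideal point. -/
abbrev PlatLine := Projectivization ℝ (Fin 2 → ℝ)

/-- The projective closure of the base space. -/
abbrev BaseSpace := Projectivization ℝ (Fin 4 → ℝ)

/-- The geometry of a pentapod with linear platform: the platform anchor points `(a i, 0, 0)` in
the moving frame and the base anchor points `M i` in the fixed frame. -/
structure Pentapod where
  a : Fin 5 → ℝ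
  M : Fin 5 → E3

namespace Pentapod

/-- The Jacobian in the pose `φ` of the platform line: its rows are the Plücker coordinates of the
carrier lines of the five legs. -/
def jacobian (P : Pentapod) (φ : ℝ →ᵃⁱ[ℝ] E3) : Matrix (Fin 5) (Fin 3 ⊕ Fin 3) ℝ :=
  Matrix.of fun i => Sum.elim (φ (P.a i) - P.M i).ofLp
    (crossProduct (P.M i).ofLp (φ (P.a i) - P.M i).ofLp)

def IsArchitecturallySingular (P : Pentapod) : Prop :=
  ∀ φ : ℝ →ᵃⁱ[ℝ] E3, (P.jacobian φ).rank < 5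

/-- The class of non-architecturally singular pentapods with linear platform such that
no three platform anchor points coincide; if two platform anchor points coincide, the remaining
three base anchor points are not collinear; no four base anchor points are collinear. -/
structure InClassP (P : Pentapod) : Prop where
  not_archSing : ¬ P.IsArchitecturallySingular
  no_three_coincide : ∀ i j k, i ≠ j → j ≠ k → i ≠ k → ¬ (P.a i = P.a j ∧ P.a j = P.a k)
  of_two_coincide : ∀ i j, i ≠ j → P.a i = P.a j → ¬ Collinear ℝ (P.M '' {i, j}ᶜ)
  no_four_collinear : ∀ i, ¬ Collinear ℝ (P.M '' {i}ᶜ)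

def IsPlanar (P : Pentapod) : Prop := Coplanar ℝ (Set.range P.M)

/-- There is an affine map onto (a part of) the platform line with `M i ↦ m i` for all `i`. -/
def AffineRelation (P : Pentapod) : Prop := ∃ κ : E3 →ᵃ[ℝ] ℝ, ∀ i, κ (P.M i) = P.a i

/-- A leg with platform anchor point `m` and base anchor point `M` (both in homogeneous
coordinates) is recorded by the `2 × 4` matrix `m Mᵀ`. For finite points its entries
`1, A, B, C, a, aA, aB, aC` are the coefficients of the sphere condition, up to the coefficient
which involves the leg length. This is the `𝕜`-span of the five legs. -/
def legSpan (𝕜 : Type*) [Field 𝕜] [Algebra ℝ 𝕜] (P : Pentapod) :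
    Submodule 𝕜 (Matrix (Fin 2) (Fin 4) 𝕜) :=
  Submodule.span 𝕜 (Set.range fun i =>
    (vecMulVec ![1, P.a i] (homog (P.M i))).map (algebraMap ℝ 𝕜))

/-- The correspondence between points of the platform line and points of the base space given by
singular-invariant leg-replacements: `m` and `M` are the anchor points of such a leg. Ideal points
are allowed. -/
def Corr (P : Pentapod) (m : PlatLine) (M : BaseSpace) : Prop :=
  vecMulVec m.rep M.rep ∈ P.legSpan ℝ

/-- Type 2: the cubic of base anchor points of leg-replacements splits up into an irreducible conic
`q` in a finite plane `ε` and a finite line `g`, not contained in `ε`, which meets `q` in the point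
`Q`. There is a bijection `σ` between `p ∖ {P₁}` and `q ∖ {Q}`, and the finite point `P₁`
corresponds to all points of `g`. Planes and lines are given by the subspaces of their homogeneous
coordinate vectors, and `q` is the zero set of the quadratic form `form`. -/
structure TypeTwo (P : Pentapod) where
  P₁ : ℝ
  ε : Submodule ℝ (Fin 4 → ℝ)
  finrank_ε : Module.finrank ℝ ε = 3
  finite_ε : ∃ v ∈ ε, v 0 ≠ 0
  form : QuadraticForm ℝ ε
  form_nondegenerate : (QuadraticMap.polarBilin form).Nondegenerate
  g : Submodule ℝ (Fin 4 → ℝ)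
  finrank_g : Module.finrank ℝ g = 2
  finite_g : ∃ v ∈ g, v 0 ≠ 0
  g_not_le : ¬ g ≤ ε
  q : Set BaseSpace
  mem_q : ∀ M : BaseSpace, M ∈ q ↔ ∃ h : M.rep ∈ ε, form ⟨M.rep, h⟩ = 0
  Q : BaseSpace
  Q_mem_q : Q ∈ q
  Q_mem_g : Q.rep ∈ g
  σ : {m : PlatLine // m ≠ .mk ℝ ![1, P₁] (platPoint_ne_zero P₁)} ≃
    {M : BaseSpace // M ∈ q ∧ M ≠ Q}
  corr_iff : ∀ (m : PlatLine) (M : BaseSpace), P.Corr m M ↔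
    (m = .mk ℝ ![1, P₁] (platPoint_ne_zero P₁) ∧ M.rep ∈ g) ∨
      ∃ h : m ≠ .mk ℝ ![1, P₁] (platPoint_ne_zero P₁), M = (σ ⟨m, h⟩ : BaseSpace)

/-- The Duporcq condition for Type 2: the conic `q` is a circle (center `c`, radius `ρ`, normal `n`
of its carrier plane), and the line `g` is orthogonal to its carrier plane. -/
def TypeTwo.Duporcq {P : Pentapod} (T : P.TypeTwo) : Prop :=
  ∃ (c n : E3) (ρ : ℝ), 0 < ρ ∧ n ≠ 0 ∧
    T.q = {M | ∃ X : E3, inner ℝ n (X - c) = 0 ∧ dist X c = ρ ∧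
      M = .mk ℝ (homog X) (homog_ne_zero X)} ∧
    idealDir n ∈ T.g

end Pentapod

/-- The nine homogeneous motion parameters `(n₀ : x₀ : … : x₃ : y₀ : … : y₃)`. -/
inductive MotionVar
  | n₀
  | x (i : Fin 4)
  | y (i : Fin 4)

namespace Motion

abbrev n₀ : MvPolynomial MotionVar ℂ := X MotionVar.n₀
abbrev x (i : Fin 4) : MvPolynomial MotionVar ℂ := X (MotionVar.x i)
abbrev y (i : Fin 4) : MvPolynomial MotionVar ℂ := X (MotionVar.y i)

def Φ₁ : MvPolynomial MotionVar ℂ := x 1 ^ 2 + x 2 ^ 2 + x 3 ^ 2 - x 0 ^ 2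
def Φ₂ : MvPolynomial MotionVar ℂ := y 1 ^ 2 + y 2 ^ 2 + y 3 ^ 2 - 8 * x 0 * n₀
def Φ₃ : MvPolynomial MotionVar ℂ := x 1 * y 1 + x 2 * y 2 + x 3 * y 3 - x 0 * y 0

/-- Sphere condition: the platform point `(a, 0, 0)` has distance `R` from `(A, B, C)`. -/
def sphereCond (a A B C' R : ℂ) : MvPolynomial MotionVar ℂ :=
  C ((a ^ 2 + A ^ 2 + B ^ 2 + C' ^ 2 - R ^ 2) / 2) * x 0
    + C (a * A) * x 1 + C (a * B) * x 2 + C (a * C') * x 3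
    + C a * y 0 + C A * y 1 + C B * y 2 + C C' * y 3 + 4 * n₀

/-- Darboux condition of the platform point `(a, 0, 0)` and the ideal base point in direction
`(A, B, C)`: the platform point stays in the plane `A X + B Y + C Z = p`. -/
def darbouxCond (a A B C' p : ℂ) : MvPolynomial MotionVar ℂ :=
  C p * x 0 + C (a * A) * x 1 + C (a * B) * x 2 + C (a * C') * x 3
    + C A * y 1 + C B * y 2 + C C' * y 3

/-- Mannheim condition of the ideal point of the platform line and the base point `(A, B, C)`: the
plane of the moving system orthogonal to the platform line at its point `(p, 0, 0)` passes through
`(A, B, C)`. -/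
def mannheimCond (A B C' p : ℂ) : MvPolynomial MotionVar ℂ :=
  C p * x 0 + C A * x 1 + C B * x 2 + C C' * x 3 + y 0

/-- The ideal of the set of complex configurations which correspond to Euclidean displacements
(so `x₀` is normalized to `1`) of a pentapod with leg conditions `F i`. -/
def configIdeal (F : Fin 5 → MvPolynomial MotionVar ℂ) : Ideal (MvPolynomial MotionVar ℂ) :=
  Ideal.span ({Φ₁, Φ₂, Φ₃, x 0 - 1} ∪ Set.range F)

/-- The dimension of the complex configuration set (`⊥` if it is empty). The pentapod has a
self-motion over `ℂ` if this dimension is positive. -/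
def configDim (F : Fin 5 → MvPolynomial MotionVar ℂ) : WithBot ℕ∞ :=
  ringKrullDim (MvPolynomial MotionVar ℂ ⧸ configIdeal F)

end Motion

namespace Pentapod

/-- The same pentapod in other Cartesian frames of the base and of the platform line. -/
def inFrames (P : Pentapod) (base : E3 ≃ᵃⁱ[ℝ] E3) (plat : ℝ ≃ᵃⁱ[ℝ] ℝ) : Pentapod where
  a i := plat (P.a i)
  M i := base (P.M i)

/-- The five sphere conditions of the pentapod with (complex) leg lengths `R i`. -/
def sphereConds (P : Pentapod) (R : Fin 5 → ℂ) : Fin 5 → MvPolynomial MotionVar ℂ := fun i =>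
  Motion.sphereCond (P.a i) (P.M i 0) (P.M i 1) (P.M i 2) (R i)

/-- The special coordinatization of a pentapod of Type 2: a choice of Cartesian frames, and of
singular-invariant leg-replacements by the five legs with platform anchor points
`0, a₂, a₃ = conj a₂, 0, ∞` and base anchor points: the origin, the ideal points in the directions
`(1, -i, 0)`, `(1, i, 0)`, `(0, 0, 1)`, and the finite point `(A₅, B₅, 0)` different from the
origin. -/
structure Coordinatization (P : Pentapod) where
  base : E3 ≃ᵃⁱ[ℝ] E3
  plat : ℝ ≃ᵃⁱ[ℝ] ℝ
  a₂ : ℂ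
  A₅ : ℝ
  B₅ : ℝ
  a₂_im : a₂.im ≠ 0
  M₅_ne : A₅ ≠ 0 ∨ B₅ ≠ 0
  leg₁ : vecMulVec ![1, 0] ![1, 0, 0, 0] ∈ (P.inFrames base plat).legSpan ℂ
  leg₂ : vecMulVec ![1, a₂] ![0, 1, -Complex.I, 0] ∈ (P.inFrames base plat).legSpan ℂ
  leg₃ : vecMulVec ![1, star a₂] ![0, 1, Complex.I, 0] ∈ (P.inFrames base plat).legSpan ℂ
  leg₄ : vecMulVec ![1, 0] ![0, 0, 0, 1] ∈ (P.inFrames base plat).legSpan ℂ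
  leg₅ : vecMulVec ![0, 1] ![1, (A₅ : ℂ), (B₅ : ℂ), 0] ∈ (P.inFrames base plat).legSpan ℂ

/-- The parameters of the five replaced legs: radius of the sphere condition, positions of the
planes of the three Darboux conditions and of the Mannheim condition. -/
@[ext] structure LegParams where
  R₁ : ℂ
  p₂ : ℂ
  p₃ : ℂ
  p₄ : ℂ
  p₅ : ℂ

namespace Coordinatization

variable {P : Pentapod}

def a₃ (c : P.Coordinatization) : ℂ := star c.a₂

/-- The pentapod with respect to the frames of the coordinatization. -/
def pentapod (c : P.Coordinatization) : Pentapod := P.inFrames c.base c.plat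

/-- The conditions `Λ₁, Ω₂, Ω₃, Ω₄, Π₅` of the replaced legs. -/
def legConds (c : P.Coordinatization) (L : LegParams) : Fin 5 → MvPolynomial MotionVar ℂ :=
  ![Motion.sphereCond 0 0 0 0 L.R₁,
    Motion.darbouxCond c.a₂ 1 (-Complex.I) 0 L.p₂,
    Motion.darbouxCond c.a₃ 1 Complex.I 0 L.p₃,
    Motion.darbouxCond 0 0 0 1 L.p₄,
    Motion.mannheimCond c.A₅ c.B₅ 0 L.p₅]

/-- The replaced legs with parameters `L` and the original legs with lengths `R` impose the same
conditions: the two systems of linear equations in the motion parameters are equivalent. -/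
def Replaces (c : P.Coordinatization) (R : Fin 5 → ℂ) (L : LegParams) : Prop :=
  Submodule.span ℂ (Set.range (c.pentapod.sphereConds R)) =
    Submodule.span ℂ (Set.range (c.legConds L))

/-- The leg parameters of the self-motions. -/
def SelfMotionParams (c : P.Coordinatization) (L : LegParams) : Prop :=
  L.p₂ = -(c.a₂ * (c.A₅ - Complex.I * c.B₅)) / c.a₃ ∧
  L.p₃ = -(c.a₃ * (c.A₅ + Complex.I * c.B₅)) / c.a₂ ∧
  L.p₄ = 0 ∧
  ((c.A₅ : ℂ) ^ 2 + (c.B₅ : ℂ) ^ 2) * (c.a₂ + c.a₃) + 2 * c.a₂ * c.a₃ * L.p₅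
    - L.R₁ ^ 2 * (c.a₂ + c.a₃) = 0

end Coordinatization

end Pentapod

end

/-! ### Krull dimension under integral extensions, and non-constant elements of domains over ℂ. -/

noncomputable section

/-! Put `U = a₂(x₁ - i x₂) + p₂` and `V = a₃(x₁ + i x₂) + p₃`. By the two isotropic Darboux
conditions these are minus `y₁ - i y₂` and minus `y₁ + i y₂`. With `x₀ = 1`, the linear conditions
make every motion parameter affine in `U`, `V`, `x₃`, and the three quadrics become `UV = K`, `a₂a₃
x₃² = p₃U + p₂V + c₁`, `lU + nV = 2a₂a₃p₄ x₃ + c₃`, where `K = R₁² - p₄²`, `l = a₂p₃ + a₃(A₅ +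
iB₅)`, `n = a₃p₂ + a₂(A₅ - iB₅)`, and `c₁`, `c₃` are constants. The equations (*) say exactly that
the third equation is void: `l = n = p₄ = c₃ = 0` (`selfMotionParams_iff`).

If it is void, the configuration set is a curve, finite over the line with coordinate `U + V`
(`configDim_eq_one`). Conversely, on a component of positive dimension the first two equations leave
no room for a nontrivial third one (`quadric_section`). The exception is `K = 0`: there `UV = 0`
splits and only one of `l`, `n` is forced to vanish. In that case `p₃ = conj p₂` makes `l` and `n`
conjugate, so both vanish.

The passage between leg lengths and leg parameters is linear algebra: both sets of leg matrices are
bases of the same space, and the parameters only enter the coefficient of `x₀`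
(`exists_span_eq_of_span_eq`).

For the existence of the frames, take `Q` and `P₁` as origins. The remaining legs are then governed
by a linear map `E` of the plane of the circle. Cramer's rule parametrizes the base points by the
platform points, and since they lie on a circle, `E` must be a similarity (`exists_similarity`). Its
complex eigenvectors are the isotropic directions, which provide the second and third leg. -/

/-- An integral injective extension of a domain of Krull dimension one has Krull dimension one. -/
theorem ringKrullDim_eq_one_of_isIntegral {R S : Type*} [CommRing R] [IsDomain R] [CommRing S]
    [Algebra R S] [Algebra.IsIntegral R S] (hinj : Function.Injective (algebraMap R S))
    (hR : ringKrullDim R = 1) : ringKrullDim S = 1 := by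
  apply le_antisymm
  · rw [← hR]
    refine Order.krullDim_le_of_strictMono (PrimeSpectrum.comap (algebraMap R S)) ?_
    intro I J h
    exact Ideal.IsIntegral.comap_lt_comap (R := R) (I := I.asIdeal) (J := J.asIdeal) h
  -- A prime lying over zero would be maximal in dimension zero, and so would its contraction,
  -- making `R` a field.
  · obtain ⟨Q, -, hQ, hQR⟩ := Ideal.exists_ideal_over_prime_of_isIntegral (S := S) (⊥ : Ideal R) ⊥
      ((Ideal.comap_bot_of_injective _ hinj).le)
    by_contra hlt
    have h0 : Ring.KrullDimLE 0 S := by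
      rw [Ring.krullDimLE_iff]
      exact Order.le_of_lt_succ (not_le.1 hlt)
    have hmax : Q.IsMaximal := hQ.isMaximal'
    have := Ideal.isMaximal_comap_of_isIntegral_of_isMaximal (R := R) Q
    rw [hQR] at this
    have hf : IsField R := Ring.isField_iff_maximal_bot.2 this
    rw [ringKrullDim_eq_zero_of_isField hf] at hR
    exact zero_ne_one hR

theorem Complex.ringKrullDim_polynomial : ringKrullDim (Polynomial ℂ) = 1 :=
  IsPrincipalIdealRing.ringKrullDim_eq_one _ (Polynomial.not_isField ℂ)

section Algebraic

variable {D : Type*} [CommRing D] [IsDomain D] [Algebra ℂ D]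

/-- An element of a domain over `ℂ` which is no constant is transcendental. -/
theorem transcendental_of_notMem_range {t : D} (ht : t ∉ Set.range (algebraMap ℂ D)) :
    Transcendental ℂ t := by
  intro h
  have hi : IsIntegral ℂ t := h.isIntegral
  apply ht
  have hirr := minpoly.irreducible hi
  have hd := IsAlgClosed.degree_eq_one_of_irreducible ℂ hirr
  exact minpoly.mem_range_of_degree_eq_one ℂ t hd

/-- Degree four suffices: it is what squaring the third equation and clearing the denominator of `V
= K / U` produces. -/
theorem coeff_eq_zero_of_notMem_range {t : D} (ht : t ∉ Set.range (algebraMap ℂ D))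
    {a b c d e : ℂ}
    (h : algebraMap ℂ D a * t ^ 4 + algebraMap ℂ D b * t ^ 3 + algebraMap ℂ D c * t ^ 2
      + algebraMap ℂ D d * t + algebraMap ℂ D e = 0) :
    a = 0 ∧ b = 0 ∧ c = 0 ∧ d = 0 ∧ e = 0 := by
  have h1 := (transcendental_iff.1 (transcendental_of_notMem_range ht))
    (Polynomial.C a * Polynomial.X ^ 4 + Polynomial.C b * Polynomial.X ^ 3
      + Polynomial.C c * Polynomial.X ^ 2 + Polynomial.C d * Polynomial.X + Polynomial.C e)
    (by simpa using h)
  have hc := fun n => congrArg (fun p => Polynomial.coeff p n) h1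
  refine ⟨?_, ?_, ?_, ?_, ?_⟩
  · simpa [Polynomial.coeff_X, Polynomial.coeff_C] using hc 4
  · simpa [Polynomial.coeff_X, Polynomial.coeff_C] using hc 3
  · simpa [Polynomial.coeff_X, Polynomial.coeff_C] using hc 2
  · simpa [Polynomial.coeff_X, Polynomial.coeff_C] using hc 1
  · simpa [Polynomial.coeff_X, Polynomial.coeff_C] using hc 0

theorem mem_range_of_sq_mem {t : D} (c : ℂ) (h : t ^ 2 = algebraMap ℂ D c) :
    t ∈ Set.range (algebraMap ℂ D) := by
  by_contra ht
  have := coeff_eq_zero_of_notMem_range ht (a := 0) (b := 0) (c := 1) (d := 0) (e := -c)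
    (by simp [h])
  simp at this

end Algebraic


/-! ### The three reduced equations on an irreducible component. -/

section Curves

variable {D : Type*} [CommRing D] [IsDomain D] [Algebra ℂ D]

local notation "κ" => algebraMap ℂ D

/-- For `K ≠ 0`, `U` cannot be constant, since `V = K / U` and `w` would be constant too. If `p₄ ≠
0`, squaring `e₃` and eliminating `w` by `e₂` gives a polynomial relation for `U`; its two top
coefficients yield `l = 0` and `p₃ = 0`, against `h₃`. For `p₄ = 0`, the product of `U` and `e₃` is
already a polynomial relation. -/
theorem hyperbola_section {U V w : D} {K m l n p₂ p₃ p₄ c₁ c₃ : ℂ}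
    (hn : ¬ (U ∈ Set.range κ ∧ V ∈ Set.range κ ∧ w ∈ Set.range κ))
    (hm : m ≠ 0) (hK : K ≠ 0) (h₃ : p₃ = 0 → l ≠ 0)
    (e₁ : U * V = κ K) (e₂ : κ m * w ^ 2 = κ p₃ * U + κ p₂ * V + κ c₁)
    (e₃ : κ l * U + κ n * V = κ (2 * m * p₄) * w + κ c₃) :
    p₄ = 0 ∧ c₃ = 0 ∧ l = 0 ∧ n = 0 := by
  have hU : U ∉ Set.range κ := by
    rintro ⟨r, rfl⟩
    have hr : r ≠ 0 := by
      rintro rfl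
      rw [map_zero, zero_mul] at e₁
      exact hK ((map_eq_zero κ).1 e₁.symm)
    have hV : V = κ (r⁻¹ * K) := by
      rw [map_mul, ← e₁, ← mul_assoc, ← map_mul, inv_mul_cancel₀ hr, map_one, one_mul]
    refine hn ⟨⟨r, rfl⟩, ⟨_, hV.symm⟩,
      mem_range_of_sq_mem (m⁻¹ * (p₃ * r + p₂ * (r⁻¹ * K) + c₁)) ?_⟩
    rw [hV, ← map_mul, ← map_mul, ← map_add, ← map_add] at e₂
    rw [map_mul, ← e₂, ← mul_assoc, ← map_mul, inv_mul_cancel₀ hm, map_one, one_mul]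
  have hp : p₄ = 0 := by
    by_contra hp
    have key := coeff_eq_zero_of_notMem_range hU (a := m * l ^ 2)
      (b := -2 * m * l * c₃ - (2 * m * p₄) ^ 2 * p₃)
      (c := m * (2 * l * n * K + c₃ ^ 2) - (2 * m * p₄) ^ 2 * c₁)
      (d := -2 * m * n * K * c₃ - (2 * m * p₄) ^ 2 * p₂ * K) (e := m * n ^ 2 * K ^ 2) (by
        have : κ m * (κ l * U + κ n * V - κ c₃) ^ 2 * U ^ 2
            = κ (2 * m * p₄) ^ 2 * (κ p₃ * U + κ p₂ * V + κ c₁) * U ^ 2 := by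
          rw [← e₂, e₃]; ring
        simp only [map_mul, map_sub, map_add, map_pow, map_neg, map_ofNat, ← e₁] at this ⊢
        linear_combination this)
    obtain ⟨k1, k2, -⟩ := key
    have hl : l = 0 := by simpa [hm] using k1
    refine h₃ ?_ hl
    simpa [hl, hm, hp] using k2
  subst hp
  have key := coeff_eq_zero_of_notMem_range hU (a := 0) (b := 0) (c := l) (d := -c₃)
    (e := n * K) (by
    simp only [map_mul, map_neg, map_zero, ← e₁] at e₃ ⊢
    linear_combination U * e₃)
  obtain ⟨-, -, k3, k4, k5⟩ := key
  exact ⟨rfl, by simpa using k4, k3, by simpa [hK] using k5⟩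

/-- One branch of the degenerate conic `UV = 0`: the vanishing coordinate hides its coefficient, so
only the other one is controlled. -/
theorem line_section {U w : D} {m l p₃ p₄ c₁ c₃ : ℂ}
    (hn : ¬ (U ∈ Set.range κ ∧ w ∈ Set.range κ))
    (hm : m ≠ 0) (h₃ : p₃ = 0 → l ≠ 0)
    (e₂ : κ m * w ^ 2 = κ p₃ * U + κ c₁)
    (e₃ : κ l * U = κ (2 * m * p₄) * w + κ c₃) :
    p₄ = 0 ∧ c₃ = 0 ∧ l = 0 := by
  have hU : U ∉ Set.range κ := by
    rintro ⟨r, rfl⟩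
    refine hn ⟨⟨r, rfl⟩, mem_range_of_sq_mem (m⁻¹ * (p₃ * r + c₁)) ?_⟩
    rw [← map_mul, ← map_add] at e₂
    rw [map_mul, ← e₂, ← mul_assoc, ← map_mul, inv_mul_cancel₀ hm, map_one, one_mul]
  have hp : p₄ = 0 := by
    by_contra hp
    have key := coeff_eq_zero_of_notMem_range hU (a := 0) (b := 0) (c := m * l ^ 2)
      (d := -2 * m * l * c₃ - (2 * m * p₄) ^ 2 * p₃)
      (e := m * c₃ ^ 2 - (2 * m * p₄) ^ 2 * c₁) (by
        have : κ m * (κ l * U - κ c₃) ^ 2 = κ (2 * m * p₄) ^ 2 * (κ p₃ * U + κ c₁) := by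
          rw [← e₂, e₃]; ring
        simp only [map_mul, map_sub, map_pow, map_neg, map_ofNat, map_zero] at this ⊢
        linear_combination this)
    obtain ⟨-, -, k1, k2, -⟩ := key
    have hl : l = 0 := by simpa [hm] using k1
    refine h₃ ?_ hl
    simpa [hl, hm, hp] using k2
  subst hp
  have key := coeff_eq_zero_of_notMem_range hU (a := 0) (b := 0) (c := 0) (d := l) (e := -c₃) (by
    simp only [map_mul, map_neg, map_zero] at e₃ ⊢
    linear_combination e₃)
  obtain ⟨-, -, -, k4, k5⟩ := key
  exact ⟨rfl, by simpa using k5, k4⟩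

/-- The weaker alternative for `K = 0` records that on the branch `U = 0` the third equation does
not see `l`, and likewise for `V` and `n`. -/
theorem quadric_section {U V w : D} {K m l n p₂ p₃ p₄ c₁ c₃ : ℂ}
    (hn : ¬ (U ∈ Set.range κ ∧ V ∈ Set.range κ ∧ w ∈ Set.range κ))
    (hm : m ≠ 0) (h₃ : p₃ = 0 → l ≠ 0) (h₂ : p₂ = 0 → n ≠ 0)
    (e₁ : U * V = κ K) (e₂ : κ m * w ^ 2 = κ p₃ * U + κ p₂ * V + κ c₁)
    (e₃ : κ l * U + κ n * V = κ (2 * m * p₄) * w + κ c₃) :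
    p₄ = 0 ∧ c₃ = 0 ∧ (l = 0 ∧ n = 0 ∨ K = 0 ∧ (l = 0 ∨ n = 0)) := by
  by_cases hK : K = 0
  · rw [hK, map_zero, mul_eq_zero] at e₁
    rcases e₁ with rfl | rfl
    · obtain ⟨k1, k2, k3⟩ := line_section (U := V) (w := w) (m := m) (l := n) (p₃ := p₂) (p₄ := p₄)
        (c₁ := c₁) (c₃ := c₃) (fun h => hn ⟨⟨0, map_zero _⟩, h⟩) hm h₂ (by simpa using e₂)
        (by simpa using e₃)
      exact ⟨k1, k2, Or.inr ⟨hK, Or.inr k3⟩⟩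
    · obtain ⟨k1, k2, k3⟩ := line_section (U := U) (w := w) (m := m) (l := l) (p₃ := p₃) (p₄ := p₄)
        (c₁ := c₁) (c₃ := c₃) (fun h => hn ⟨h.1, ⟨0, map_zero _⟩, h.2⟩) hm h₃ (by simpa using e₂)
        (by simpa using e₃)
      exact ⟨k1, k2, Or.inr ⟨hK, Or.inl k3⟩⟩
  · obtain ⟨k1, k2, k3, k4⟩ := hyperbola_section hn hm hK h₃ e₁ e₂ e₃
    exact ⟨k1, k2, Or.inl ⟨k3, k4⟩⟩

end Curves

/-! ### Reduction of the configuration equations to `U`, `V` and `x₃`. -/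

namespace Pentapod.Coordinatization

variable {P : Pentapod} (c : P.Coordinatization)

theorem a₂_ne_zero : c.a₂ ≠ 0 := fun h => c.a₂_im (by simp [h])

theorem a₃_ne_zero : c.a₃ ≠ 0 := by simpa [a₃] using c.a₂_ne_zero

theorem A₅_add_ne_zero : (c.A₅ : ℂ) + Complex.I * c.B₅ ≠ 0 := fun h => by
  have h1 := congrArg Complex.re h
  have h2 := congrArg Complex.im h
  simp at h1 h2
  rcases c.M₅_ne with h | h
  · exact h h1
  · exact h h2

theorem A₅_sub_ne_zero : (c.A₅ : ℂ) - Complex.I * c.B₅ ≠ 0 := fun h => by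
  have h1 := congrArg Complex.re h
  have h2 := congrArg Complex.im h
  simp at h1 h2
  rcases c.M₅_ne with h | h
  · exact h h1
  · exact h h2

/-- Minus the isotropic component `y₁ - i y₂` of the reduced configurations. -/
def U (L : LegParams) : MvPolynomial MotionVar ℂ :=
  C c.a₂ * (Motion.x 1 - C Complex.I * Motion.x 2) + C L.p₂

def V (L : LegParams) : MvPolynomial MotionVar ℂ :=
  C c.a₃ * (Motion.x 1 + C Complex.I * Motion.x 2) + C L.p₃

section Equations

variable {B : Type*} [CommRing B] [Algebra ℂ B] (φ : MvPolynomial MotionVar ℂ →ₐ[ℂ] B)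
  (L : LegParams)

local notation "κ" => algebraMap ℂ B

theorem I_sq_eq : κ Complex.I ^ 2 = -1 := by
  rw [← map_pow, Complex.I_sq, map_neg, map_one]

theorem vanish_iff :
    (∀ p ∈ Motion.configIdeal (c.legConds L), φ p = 0) ↔
      φ Motion.Φ₁ = 0 ∧ φ Motion.Φ₂ = 0 ∧ φ Motion.Φ₃ = 0 ∧ φ (Motion.x 0) = 1 ∧
        ∀ i, φ (c.legConds L i) = 0 := by
  constructor
  · intro h
    have h' := fun p hp => h p (Ideal.subset_span hp)
    refine ⟨h' _ (by simp), h' _ (by simp), h' _ (by simp), ?_, fun i => h' _ (by simp)⟩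
    have := h' (Motion.x 0 - 1) (by simp)
    simpa [sub_eq_zero] using this
  · rintro ⟨h1, h2, h3, h4, h5⟩ p hp
    refine (Ideal.span_le (I := RingHom.ker φ)).2 ?_ hp
    rintro q ((rfl | rfl | rfl | rfl) | ⟨i, rfl⟩)
    · exact h1
    · exact h2
    · exact h3
    · simp [RingHom.mem_ker, h4]
    · exact h5 i

/-- The reduced equations of the configuration set in terms of `U`, `V` and `x₃`. -/
structure Reduced : Prop where
  x₀ : φ (Motion.x 0) = 1
  x₁ : φ (Motion.x 1) = κ (1 / (2 * c.a₂)) * (φ (c.U L) - κ L.p₂)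
    + κ (1 / (2 * c.a₃)) * (φ (c.V L) - κ L.p₃)
  x₂ : φ (Motion.x 2) = κ (Complex.I / (2 * c.a₂)) * (φ (c.U L) - κ L.p₂)
    - κ (Complex.I / (2 * c.a₃)) * (φ (c.V L) - κ L.p₃)
  y₀ : φ (Motion.y 0) = - κ L.p₅ - κ c.A₅ * φ (Motion.x 1) - κ c.B₅ * φ (Motion.x 2)
  y₁ : φ (Motion.y 1) = κ (-1 / 2) * (φ (c.U L) + φ (c.V L))
  y₂ : φ (Motion.y 2) = κ (-Complex.I / 2) * (φ (c.U L) - φ (c.V L))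
  y₃ : φ (Motion.y 3) = - κ L.p₄
  n₀ : φ Motion.n₀ = κ (L.R₁ ^ 2 / 8)
  eq₁ : φ (c.U L) * φ (c.V L) = κ (L.R₁ ^ 2 - L.p₄ ^ 2)
  eq₂ : κ (c.a₂ * c.a₃) * φ (Motion.x 3) ^ 2 = κ L.p₃ * φ (c.U L) + κ L.p₂ * φ (c.V L)
    + κ (c.a₂ * c.a₃ - (L.R₁ ^ 2 - L.p₄ ^ 2) - L.p₂ * L.p₃)
  eq₃ : κ (c.a₂ * L.p₃ + c.a₃ * (c.A₅ + Complex.I * c.B₅)) * φ (c.U L)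
      + κ (c.a₃ * L.p₂ + c.a₂ * (c.A₅ - Complex.I * c.B₅)) * φ (c.V L)
    = κ (2 * (c.a₂ * c.a₃) * L.p₄) * φ (Motion.x 3)
      + κ ((c.a₂ + c.a₃) * (L.R₁ ^ 2 - L.p₄ ^ 2) + c.a₃ * (c.A₅ + Complex.I * c.B₅) * L.p₂
        + c.a₂ * (c.A₅ - Complex.I * c.B₅) * L.p₃ - 2 * (c.a₂ * c.a₃) * L.p₅)

end Equations

end Pentapod.Coordinatization

namespace Pentapod.Coordinatization

variable {P : Pentapod} (c : P.Coordinatization)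
section Equations

variable {B : Type*} [CommRing B] [Algebra ℂ B] (φ : MvPolynomial MotionVar ℂ →ₐ[ℂ] B)
  (L : LegParams)

local notation "κ" => algebraMap ℂ B

theorem map_U : φ (c.U L) =
    κ c.a₂ * (φ (Motion.x 1) - κ Complex.I * φ (Motion.x 2)) + κ L.p₂ := by
  simp [U, ← MvPolynomial.algebraMap_eq]

theorem map_V : φ (c.V L) =
    κ c.a₃ * (φ (Motion.x 1) + κ Complex.I * φ (Motion.x 2)) + κ L.p₃ := by
  simp [V, ← MvPolynomial.algebraMap_eq]

theorem map_legConds : (∀ i, φ (c.legConds L i) = 0) ↔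
    (κ (-L.R₁ ^ 2 / 2) * φ (Motion.x 0) + 4 * φ Motion.n₀ = 0 ∧
    κ L.p₂ * φ (Motion.x 0) + κ c.a₂ * (φ (Motion.x 1) - κ Complex.I * φ (Motion.x 2))
      + φ (Motion.y 1) - κ Complex.I * φ (Motion.y 2) = 0 ∧
    κ L.p₃ * φ (Motion.x 0) + κ c.a₃ * (φ (Motion.x 1) + κ Complex.I * φ (Motion.x 2))
      + φ (Motion.y 1) + κ Complex.I * φ (Motion.y 2) = 0 ∧
    κ L.p₄ * φ (Motion.x 0) + φ (Motion.y 3) = 0 ∧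
    κ L.p₅ * φ (Motion.x 0) + κ c.A₅ * φ (Motion.x 1) + κ c.B₅ * φ (Motion.x 2)
      + φ (Motion.y 0) = 0) := by
  simp only [Fin.forall_fin_succ, legConds, Motion.sphereCond, Motion.darbouxCond,
    Motion.mannheimCond, ← MvPolynomial.algebraMap_eq]
  have h4 : φ 4 = 4 := map_ofNat φ 4
  simp [mul_add, mul_assoc, sub_eq_add_neg, add_assoc, h4]

/-- The quadrics factor in isotropic coordinates: `x₁² + x₂² = (x₁ - i x₂)(x₁ + i x₂)`, similarly
for `y`, and `2(x₁y₁ + x₂y₂) = (x₁ - i x₂)(y₁ + i y₂) + (x₁ + i x₂)(y₁ - i y₂)`. The algebra `B` is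
arbitrary because the result serves for ℂ-points, for the coordinate ring and for its quotients by
primes. -/
theorem vanish_iff_reduced :
    (∀ p ∈ Motion.configIdeal (c.legConds L), φ p = 0) ↔ c.Reduced φ L := by
  rw [vanish_iff, map_legConds]
  have i2 : κ Complex.I ^ 2 = -1 := I_sq_eq
  have hh : κ (1 / 2) * 2 = 1 := by
    rw [← map_ofNat κ 2, ← map_mul]; norm_num
  have ha : κ c.a₂ * κ (c.a₂⁻¹) = 1 := by
    rw [← map_mul, mul_inv_cancel₀ c.a₂_ne_zero, map_one]
  have hb : κ c.a₃ * κ (c.a₃⁻¹) = 1 := by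
    rw [← map_mul, mul_inv_cancel₀ c.a₃_ne_zero, map_one]
  have r1 : κ (1 / (2 * c.a₂)) = κ (1 / 2) * κ (c.a₂⁻¹) := by
    rw [← map_mul]; congr 1; field_simp
  have r2 : κ (1 / (2 * c.a₃)) = κ (1 / 2) * κ (c.a₃⁻¹) := by
    rw [← map_mul]; congr 1; field_simp
  have r3 : κ (Complex.I / (2 * c.a₂)) = κ Complex.I * κ (1 / 2) * κ (c.a₂⁻¹) := by
    rw [← map_mul, ← map_mul]; congr 1; field_simp
  have r4 : κ (Complex.I / (2 * c.a₃)) = κ Complex.I * κ (1 / 2) * κ (c.a₃⁻¹) := by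
    rw [← map_mul, ← map_mul]; congr 1; field_simp
  have r5 : κ (-1 / 2) = - κ (1 / 2) := by
    rw [← map_neg]; congr 1; ring
  have r6 : κ (-Complex.I / 2) = - (κ Complex.I * κ (1 / 2)) := by
    rw [← map_mul, ← map_neg]; congr 1; ring
  have r7 : κ (L.R₁ ^ 2 / 8) = κ L.R₁ ^ 2 * κ (1 / 2) ^ 3 := by
    rw [← map_pow, ← map_pow, ← map_mul]; congr 1; ring
  have r8 : κ (-L.R₁ ^ 2 / 2) = - (κ L.R₁ ^ 2 * κ (1 / 2)) := by
    rw [← map_pow, ← map_mul, ← map_neg]; congr 1; ring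
  have hU := c.map_U φ L
  have hV := c.map_V φ L
  simp only [Motion.Φ₁, Motion.Φ₂, Motion.Φ₃, map_add, map_sub, map_mul, map_pow, map_ofNat]
  -- From here on only `i² = -1`, `2h = 1`, `a₂a' = 1` and `a₃b' = 1` matter, so the goals become
  -- polynomial identities in `B`.
  obtain ⟨i, rI⟩ : ∃ i, κ Complex.I = i := ⟨_, rfl⟩
  rw [rI] at i2 r3 r4 r6 hU hV
  simp only [rI]
  generalize κ (1 / 2) = h at hh r1 r2 r3 r4 r5 r6 r7 r8
  generalize κ c.a₂⁻¹ = a' at ha r1 r3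
  generalize κ c.a₃⁻¹ = b' at hb r2 r4
  constructor
  · rintro ⟨f1, f2, f3, f0, g1, g2, g3, g4, g5⟩
    rw [f0] at f1 f2 f3 g1 g2 g3 g4 g5
    rw [r8] at g1
    have y3 : φ (Motion.y 3) = - κ L.p₄ := by linear_combination g4
    have y0 : φ (Motion.y 0) = - κ L.p₅ - κ c.A₅ * φ (Motion.x 1) - κ c.B₅ * φ (Motion.x 2) := by
      linear_combination g5
    have hn : φ Motion.n₀ = κ L.R₁ ^ 2 * h ^ 3 := by
      linear_combination h ^ 2 * g1 - (2 * h + 1) * φ Motion.n₀ * hh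
    have sU : φ (c.U L) = - (φ (Motion.y 1) - i * φ (Motion.y 2)) := by
      linear_combination hU + g2
    have sV : φ (c.V L) = - (φ (Motion.y 1) + i * φ (Motion.y 2)) := by
      linear_combination hV + g3
    have e1 : φ (c.U L) * φ (c.V L) = κ L.R₁ ^ 2 - κ L.p₄ ^ 2 := by
      rw [sU, sV]
      rw [y3, hn] at f2
      linear_combination f2 - φ (Motion.y 2) ^ 2 * i2 + κ L.R₁ ^ 2 * (4 * h ^ 2 + 2 * h + 1) * hh
    have x3 : φ (Motion.x 3) ^ 2 = 1 - φ (Motion.x 1) ^ 2 - φ (Motion.x 2) ^ 2 := by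
      linear_combination f1
    refine ⟨f0, ?_, ?_, y0, ?_, ?_, y3, ?_, ?_, ?_, ?_⟩
    · rw [r1, r2, hU, hV]
      linear_combination - φ (Motion.x 1) * hh - h * (φ (Motion.x 1) - i * φ (Motion.x 2)) * ha
        - h * (φ (Motion.x 1) + i * φ (Motion.x 2)) * hb
    · rw [r3, r4, hU, hV]
      linear_combination - φ (Motion.x 2) * hh + 2 * h * φ (Motion.x 2) * i2
        - i * h * (φ (Motion.x 1) - i * φ (Motion.x 2)) * ha
        + i * h * (φ (Motion.x 1) + i * φ (Motion.x 2)) * hb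
    · rw [r5, sU, sV]
      linear_combination - φ (Motion.y 1) * hh
    · rw [r6, sU, sV]
      linear_combination 2 * h * φ (Motion.y 2) * i2 - φ (Motion.y 2) * hh
    · rw [hn, r7]
    · simp only [map_sub, map_pow, e1]
    · simp only [map_sub, map_mul, map_pow]
      rw [x3, ← e1, hU, hV]
      linear_combination (- κ c.a₂ * κ c.a₃ * φ (Motion.x 2) ^ 2) * i2
    · simp only [map_add, map_sub, map_mul, map_pow, map_ofNat, rI]
      rw [y3, y0] at f3
      rw [← e1]
      linear_combination 2 * κ c.a₂ * κ c.a₃ * f3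
        - κ c.a₂ * κ c.a₃ * (φ (Motion.x 1) - i * φ (Motion.x 2)) * sV
        - κ c.a₂ * κ c.a₃ * (φ (Motion.x 1) + i * φ (Motion.x 2)) * sU
        - κ c.a₃ * φ (c.V L) * hU - κ c.a₂ * φ (c.U L) * hV
        - 2 * κ c.a₂ * κ c.a₃ * φ (Motion.x 2) * (φ (Motion.y 2) + κ c.B₅) * i2
        + κ c.a₃ * (κ c.A₅ + i * κ c.B₅) * hU + κ c.a₂ * (κ c.A₅ - i * κ c.B₅) * hV
  · intro H
    have e1 := H.eq₁
    have e2 := H.eq₂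
    have e3 := H.eq₃
    have hy1 := H.y₁
    have hy2 := H.y₂
    rw [H.y₀, H.y₃, H.n₀, H.x₀, r7, r8]
    simp only [map_add, map_sub, map_mul, map_pow, map_ofNat, rI] at e1 e2 e3
    rw [r5] at hy1
    rw [r6] at hy2
    have sU : φ (c.U L) = - (φ (Motion.y 1) - i * φ (Motion.y 2)) := by
      linear_combination hy1 - i * hy2 + h * (φ (c.U L) - φ (c.V L)) * i2 - φ (c.U L) * hh
    have sV : φ (c.V L) = - (φ (Motion.y 1) + i * φ (Motion.y 2)) := by
      linear_combination hy1 + i * hy2 - h * (φ (c.U L) - φ (c.V L)) * i2 - φ (c.V L) * hh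
    -- The reduced equations return `Φ₁` and `Φ₃` only up to the factors `a₂a₃` and `2a₂a₃`, which
    -- are units.
    have hm : κ c.a₂ * κ c.a₃ * (a' * b') = 1 := by
      linear_combination κ c.a₃ * b' * ha + hb
    have cancel : ∀ G : B, κ c.a₂ * κ c.a₃ * G = 0 → G = 0 := fun G hG => by
      linear_combination a' * b' * hG - G * hm
    have cancel₂ : ∀ G : B, 2 * G = 0 → G = 0 := fun G hG => by
      linear_combination h * hG - G * hh
    refine ⟨cancel _ ?_, ?_, cancel₂ _ (cancel _ ?_), rfl, ?_, ?_, ?_, ?_, ?_⟩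
    · linear_combination e2 + e1 + κ c.a₂ * κ c.a₃ * φ (Motion.x 2) ^ 2 * i2
        - κ c.a₃ * (φ (Motion.x 1) + i * φ (Motion.x 2)) * hU
        - (φ (c.U L) - κ L.p₂) * hV
    · linear_combination e1 + (φ (Motion.y 1) + i * φ (Motion.y 2)) * sU - φ (c.U L) * sV
        + φ (Motion.y 2) ^ 2 * i2 - κ L.R₁ ^ 2 * (4 * h ^ 2 + 2 * h + 1) * hh
    · linear_combination e3 - (κ c.a₂ + κ c.a₃) * e1
        + κ c.a₂ * κ c.a₃ * (φ (Motion.x 1) - i * φ (Motion.x 2)) * sV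
        + κ c.a₂ * κ c.a₃ * (φ (Motion.x 1) + i * φ (Motion.x 2)) * sU
        + κ c.a₃ * φ (c.V L) * hU + κ c.a₂ * φ (c.U L) * hV
        + 2 * κ c.a₂ * κ c.a₃ * φ (Motion.x 2) * (φ (Motion.y 2) + κ c.B₅) * i2
        - κ c.a₃ * (κ c.A₅ + i * κ c.B₅) * hU - κ c.a₂ * (κ c.A₅ - i * κ c.B₅) * hV
    · linear_combination κ L.R₁ ^ 2 * h * (2 * h + 1) * hh
    · linear_combination sU - hU
    · linear_combination sV - hV
    · ring
    · ring

end Equations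
end Pentapod.Coordinatization

/-! ### Dimension of the configuration set in terms of the leg parameters. -/

namespace Pentapod.Coordinatization

variable {P : Pentapod} (c : P.Coordinatization)

theorem reduced_mk (L : LegParams) :
    c.Reduced (Ideal.Quotient.mkₐ ℂ (Motion.configIdeal (c.legConds L))) L :=
  (c.vanish_iff_reduced _ L).1 fun _ hp => Ideal.Quotient.eq_zero_iff_mem.2 hp

/-- The right-hand side is the vanishing of all coefficients of `eq₃`, given that `a₂a₃ ≠ 0`. -/
theorem selfMotionParams_iff (L : LegParams) : c.SelfMotionParams L ↔
    c.a₂ * L.p₃ + c.a₃ * (c.A₅ + Complex.I * c.B₅) = 0 ∧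
    c.a₃ * L.p₂ + c.a₂ * (c.A₅ - Complex.I * c.B₅) = 0 ∧ L.p₄ = 0 ∧
    (c.a₂ + c.a₃) * (L.R₁ ^ 2 - L.p₄ ^ 2) + c.a₃ * (c.A₅ + Complex.I * c.B₅) * L.p₂
        + c.a₂ * (c.A₅ - Complex.I * c.B₅) * L.p₃ - 2 * (c.a₂ * c.a₃) * L.p₅ = 0 := by
  have ha := c.a₂_ne_zero
  have hb := c.a₃_ne_zero
  have i2 := Complex.I_sq
  unfold SelfMotionParams
  constructor
  · rintro ⟨h2, h3, h4, h5⟩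
    have k2 : c.a₃ * L.p₂ + c.a₂ * (c.A₅ - Complex.I * c.B₅) = 0 := by
      rw [h2]; field_simp; ring
    have k3 : c.a₂ * L.p₃ + c.a₃ * (c.A₅ + Complex.I * c.B₅) = 0 := by
      rw [h3]; field_simp; ring
    refine ⟨k3, k2, h4, ?_⟩
    rw [h4]
    linear_combination (c.A₅ + Complex.I * c.B₅) * k2 + (c.A₅ - Complex.I * c.B₅) * k3 - h5
      + (c.a₂ + c.a₃) * c.B₅ ^ 2 * i2
  · rintro ⟨k3, k2, h4, h5⟩
    refine ⟨?_, ?_, h4, ?_⟩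
    · rw [eq_div_iff hb]; linear_combination k2
    · rw [eq_div_iff ha]; linear_combination k3
    · rw [h4] at h5
      linear_combination (c.A₅ + Complex.I * c.B₅) * k2 + (c.A₅ - Complex.I * c.B₅) * k3 - h5
        + (c.a₂ + c.a₃) * c.B₅ ^ 2 * i2

/-- Configurations over `ℂ` with a prescribed value of `U + V`. -/
theorem exists_config {L : LegParams} (hL : c.SelfMotionParams L) (s : ℂ) :
    ∃ ψ : MvPolynomial MotionVar ℂ →ₐ[ℂ] ℂ, (∀ p ∈ Motion.configIdeal (c.legConds L), ψ p = 0) ∧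
      ψ (c.U L) + ψ (c.V L) = s := by
  have ha := c.a₂_ne_zero
  have hb := c.a₃_ne_zero
  have i2 := Complex.I_sq
  obtain ⟨k3, k2, h4, h5⟩ := (c.selfMotionParams_iff L).1 hL
  -- `u` and `v` are the roots of `t² - s t + (R₁² - p₄²)`, with `d` a square root of the
  -- discriminant.
  obtain ⟨d, hd⟩ := IsAlgClosed.exists_pow_nat_eq (s ^ 2 - 4 * (L.R₁ ^ 2 - L.p₄ ^ 2)) two_pos
  obtain ⟨u, hu⟩ : ∃ u, u = (s + d) / 2 := ⟨_, rfl⟩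
  obtain ⟨v, hv⟩ : ∃ v, v = (s - d) / 2 := ⟨_, rfl⟩
  have huv : u * v = L.R₁ ^ 2 - L.p₄ ^ 2 := by
    rw [hu, hv]; linear_combination (-1 / 4) * hd
  have hs : u + v = s := by rw [hu, hv]; ring
  obtain ⟨w, hw⟩ := IsAlgClosed.exists_pow_nat_eq ((L.p₃ * u + L.p₂ * v
    + (c.a₂ * c.a₃ - (L.R₁ ^ 2 - L.p₄ ^ 2) - L.p₂ * L.p₃)) / (c.a₂ * c.a₃)) two_pos
  obtain ⟨x₁, hx₁⟩ : ∃ x₁, x₁ = 1 / (2 * c.a₂) * (u - L.p₂) + 1 / (2 * c.a₃) * (v - L.p₃) :=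
    ⟨_, rfl⟩
  obtain ⟨x₂, hx₂⟩ : ∃ x₂, x₂ = Complex.I / (2 * c.a₂) * (u - L.p₂)
    - Complex.I / (2 * c.a₃) * (v - L.p₃) := ⟨_, rfl⟩
  let ψ : MvPolynomial MotionVar ℂ →ₐ[ℂ] ℂ := aeval fun
    | .n₀ => L.R₁ ^ 2 / 8
    | .x i => ![1, x₁, x₂, w] i
    | .y i => ![- L.p₅ - c.A₅ * x₁ - c.B₅ * x₂, -1 / 2 * (u + v), -Complex.I / 2 * (u - v),
        - L.p₄] i
  have hU : ψ (c.U L) = u := by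
    rw [map_U]
    simp only [ψ, aeval_X, Algebra.algebraMap_self, RingHom.id_apply]
    simp only [Matrix.cons_val]
    rw [hx₁, hx₂]
    field_simp
    linear_combination (-c.a₃ * (u - L.p₂) + c.a₂ * (v - L.p₃)) * i2
  have hV : ψ (c.V L) = v := by
    rw [map_V]
    simp only [ψ, aeval_X, Algebra.algebraMap_self, RingHom.id_apply]
    simp only [Matrix.cons_val]
    rw [hx₁, hx₂]
    field_simp
    linear_combination (c.a₃ * (u - L.p₂) - c.a₂ * (v - L.p₃)) * i2
  refine ⟨ψ, (c.vanish_iff_reduced ψ L).2 ?_, by rw [hU, hV, hs]⟩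
  constructor <;> try simp only [hU, hV, Algebra.algebraMap_self, RingHom.id_apply]
  · simp [ψ]
  · simp [ψ, hx₁]
  · simp [ψ, hx₂]
  · simp [ψ]
  · simp [ψ]
  · simp [ψ]
  · simp [ψ]
  · simp [ψ]
  · exact huv
  · have : ψ (Motion.x 3) = w := by simp [ψ]
    rw [this, hw]
    field_simp
  · linear_combination u * k3 + v * k2 - 2 * (c.a₂ * c.a₃) * ψ (Motion.x 3) * h4 - h5

/-- The coordinate ring is integral over `ℂ[U + V]`: `U` is a root of `t² - (U + V)t + K`, `x₃²` is
affine in `U`, `V`, and the other coordinates are affine in `U`, `V`. -/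
theorem configDim_eq_one {L : LegParams} (hL : c.SelfMotionParams L) :
    Motion.configDim (c.legConds L) = 1 := by
  have ha := c.a₂_ne_zero
  have hb := c.a₃_ne_zero
  set J := Motion.configIdeal (c.legConds L) with hJ
  set φ := Ideal.Quotient.mkₐ ℂ J with hφ
  have H : c.Reduced φ L := c.reduced_mk L
  let f : Polynomial ℂ →ₐ[ℂ] (MvPolynomial MotionVar ℂ ⧸ J) :=
    Polynomial.aeval (φ (c.U L) + φ (c.V L))
  let _ : Algebra (Polynomial ℂ) (MvPolynomial MotionVar ℂ ⧸ J) := f.toRingHom.toAlgebra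
  have hf : ∀ p : Polynomial ℂ, algebraMap (Polynomial ℂ) (MvPolynomial MotionVar ℂ ⧸ J) p = f p :=
    fun _ => rfl
  have hC : ∀ r : ℂ, IsIntegral (Polynomial ℂ)
      (algebraMap ℂ (MvPolynomial MotionVar ℂ ⧸ J) r) := fun r => by
    have : algebraMap ℂ (MvPolynomial MotionVar ℂ ⧸ J) r
        = algebraMap (Polynomial ℂ) (MvPolynomial MotionVar ℂ ⧸ J) (Polynomial.C r) := by
      simp [hf, f]
    rw [this]
    exact isIntegral_algebraMap
  have hs : IsIntegral (Polynomial ℂ) (φ (c.U L) + φ (c.V L)) := by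
    have : φ (c.U L) + φ (c.V L)
        = algebraMap (Polynomial ℂ) (MvPolynomial MotionVar ℂ ⧸ J) Polynomial.X := by
      simp [hf, f]
    rw [this]
    exact isIntegral_algebraMap
  have hU : IsIntegral (Polynomial ℂ) (φ (c.U L)) := by
    refine ⟨Polynomial.X ^ 2 - Polynomial.C Polynomial.X * Polynomial.X
      + Polynomial.C (Polynomial.C (L.R₁ ^ 2 - L.p₄ ^ 2)), by monicity!, ?_⟩
    simp only [Polynomial.eval₂_add, Polynomial.eval₂_sub, Polynomial.eval₂_mul,
      Polynomial.eval₂_pow, Polynomial.eval₂_X, Polynomial.eval₂_C, hf]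
    have h1 : f Polynomial.X = φ (c.U L) + φ (c.V L) := by simp [f]
    have h2 : f (Polynomial.C (L.R₁ ^ 2 - L.p₄ ^ 2)) = φ (c.U L) * φ (c.V L) := by
      rw [H.eq₁]; simp only [f, Polynomial.aeval_C]
    rw [h1, h2]; ring
  have hV : IsIntegral (Polynomial ℂ) (φ (c.V L)) := by
    have := hs.sub hU
    rwa [add_sub_cancel_left] at this
  have hw : IsIntegral (Polynomial ℂ) (φ (Motion.x 3)) := by
    refine IsIntegral.of_pow two_pos ?_
    have : φ (Motion.x 3) ^ 2 = algebraMap ℂ _ ((c.a₂ * c.a₃)⁻¹)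
        * (algebraMap ℂ _ (c.a₂ * c.a₃) * φ (Motion.x 3) ^ 2) := by
      rw [← mul_assoc, ← map_mul, inv_mul_cancel₀ (mul_ne_zero ha hb), map_one, one_mul]
    rw [this, H.eq₂]
    exact (hC _).mul ((((hC _).mul hU).add ((hC _).mul hV)).add (hC _))
  have hx1 : IsIntegral (Polynomial ℂ) (φ (Motion.x 1)) := by
    rw [H.x₁]
    exact ((hC _).mul (hU.sub (hC _))).add ((hC _).mul (hV.sub (hC _)))
  have hx2 : IsIntegral (Polynomial ℂ) (φ (Motion.x 2)) := by
    rw [H.x₂]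
    exact ((hC _).mul (hU.sub (hC _))).sub ((hC _).mul (hV.sub (hC _)))
  have hvar : ∀ v : MotionVar, IsIntegral (Polynomial ℂ) (φ (X v)) := by
    rintro (_ | i | i)
    · rw [H.n₀]; exact hC _
    · fin_cases i
      · change IsIntegral _ (φ (Motion.x 0))
        rw [H.x₀]; exact isIntegral_one
      · exact hx1
      · exact hx2
      · exact hw
    · fin_cases i
      · change IsIntegral _ (φ (Motion.y 0))
        rw [H.y₀]
        exact ((hC _).neg.sub ((hC _).mul hx1)).sub ((hC _).mul hx2)
      · change IsIntegral _ (φ (Motion.y 1))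
        rw [H.y₁]
        exact (hC _).mul (hU.add hV)
      · change IsIntegral _ (φ (Motion.y 2))
        rw [H.y₂]
        exact (hC _).mul (hU.sub hV)
      · change IsIntegral _ (φ (Motion.y 3))
        rw [H.y₃]; exact (hC _).neg
  have hint : Algebra.IsIntegral (Polynomial ℂ) (MvPolynomial MotionVar ℂ ⧸ J) := by
    refine ⟨fun z => ?_⟩
    obtain ⟨p, rfl⟩ := Ideal.Quotient.mkₐ_surjective ℂ J z
    induction p using MvPolynomial.induction_on with
    | C r => exact hC r
    | add p q hp hq => rw [map_add]; exact hp.add hq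
    | mul_X p v hp => rw [map_mul]; exact hp.mul (hvar v)
  refine ringKrullDim_eq_one_of_isIntegral (R := Polynomial ℂ) ?_ Complex.ringKrullDim_polynomial
  -- `U + V` satisfies no polynomial relation, since `exists_config` gives a configuration for each
  -- of its values.
  rw [injective_iff_map_eq_zero]
  intro q hq
  refine Polynomial.funext fun s => ?_
  obtain ⟨ψ, hψ, hsum⟩ := c.exists_config hL s
  have h1 : Ideal.Quotient.liftₐ J ψ hψ (f q) = 0 := by rw [← hf, hq, map_zero]
  simp only [f] at h1
  rw [← Polynomial.aeval_algHom_apply, map_add] at h1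
  have h2 : ∀ p, Ideal.Quotient.liftₐ J ψ hψ (φ p) = ψ p := fun p =>
    Ideal.Quotient.lift_mk J _ _
  rw [h2, h2, hsum, Polynomial.aeval_def, Polynomial.eval₂_eq_eval_map] at h1
  simpa using h1

/-- A positive dimensional irreducible part of the configuration set forces the leg parameters of
the self-motions. -/
theorem selfMotionParams_of_surjective {L : LegParams} (hR : L.R₁ ≠ 0 ∨ L.p₃ = star L.p₂)
    {D : Type*} [CommRing D] [IsDomain D] [Algebra ℂ D] (φ : MvPolynomial MotionVar ℂ →ₐ[ℂ] D)
    (hφs : Function.Surjective φ) (hD : ¬ IsField D)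
    (hφ₀ : ∀ p ∈ Motion.configIdeal (c.legConds L), φ p = 0) : c.SelfMotionParams L := by
  have ha := c.a₂_ne_zero
  have hb := c.a₃_ne_zero
  have H : c.Reduced φ L := (c.vanish_iff_reduced φ L).1 hφ₀
  -- If all three were constant, every generator would have constant image, so `D` would be ℂ, a
  -- field.
  have hn : ¬ (φ (c.U L) ∈ (⊥ : Subalgebra ℂ _) ∧ φ (c.V L) ∈ (⊥ : Subalgebra ℂ _)
      ∧ φ (Motion.x 3) ∈ (⊥ : Subalgebra ℂ _)) := by
    rintro ⟨hU, hV, hw⟩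
    have hC := fun r => (⊥ : Subalgebra ℂ D).algebraMap_mem r
    have hx1 : φ (Motion.x 1) ∈ (⊥ : Subalgebra ℂ _) := by
      rw [H.x₁]
      exact add_mem (mul_mem (hC _) (sub_mem hU (hC _))) (mul_mem (hC _) (sub_mem hV (hC _)))
    have hx2 : φ (Motion.x 2) ∈ (⊥ : Subalgebra ℂ _) := by
      rw [H.x₂]
      exact sub_mem (mul_mem (hC _) (sub_mem hU (hC _))) (mul_mem (hC _) (sub_mem hV (hC _)))
    have hvar : ∀ v : MotionVar, φ (X v) ∈ (⊥ : Subalgebra ℂ _) := by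
      rintro (_ | i | i)
      · rw [H.n₀]; exact hC _
      · fin_cases i
        · change φ (Motion.x 0) ∈ _
          rw [H.x₀]; exact one_mem _
        · exact hx1
        · exact hx2
        · exact hw
      · fin_cases i
        · change φ (Motion.y 0) ∈ _
          rw [H.y₀]
          exact sub_mem (sub_mem (neg_mem (hC _)) (mul_mem (hC _) hx1)) (mul_mem (hC _) hx2)
        · change φ (Motion.y 1) ∈ _
          rw [H.y₁]
          exact mul_mem (hC _) (add_mem hU hV)
        · change φ (Motion.y 2) ∈ _
          rw [H.y₂]
          exact mul_mem (hC _) (sub_mem hU hV)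
        · change φ (Motion.y 3) ∈ _
          rw [H.y₃]; exact neg_mem (hC _)
    have hsurj : Function.Surjective (algebraMap ℂ D) := by
      intro z
      obtain ⟨p, rfl⟩ := hφs z
      refine Algebra.mem_bot.1 ?_
      induction p using MvPolynomial.induction_on with
      | C r => rw [← MvPolynomial.algebraMap_eq, AlgHom.commutes]; exact hC r
      | add p q hp hq => rw [map_add]; exact add_mem hp hq
      | mul_X p v hp => rw [map_mul]; exact mul_mem hp (hvar v)
    exact hD ((RingEquiv.ofBijective _ ⟨RingHom.injective _, hsurj⟩).symm.toMulEquiv.isField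
      (Field.toIsField ℂ))
  simp only [Algebra.mem_bot] at hn
  -- For `p₃ = 0` the coefficient `l` is `a₃(A₅ + iB₅)`, nonzero because `(A₅, B₅)` is real and
  -- nonzero; similarly for `n`.
  obtain ⟨k4, k5, k6⟩ := quadric_section hn (mul_ne_zero ha hb)
    (fun h => by rw [h, mul_zero, zero_add]; exact mul_ne_zero hb c.A₅_add_ne_zero)
    (fun h => by rw [h, mul_zero, zero_add]; exact mul_ne_zero ha c.A₅_sub_ne_zero)
    H.eq₁ H.eq₂ H.eq₃
  refine (c.selfMotionParams_iff L).2 ?_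
  rcases k6 with ⟨k2, k3⟩ | ⟨hK, h⟩
  · exact ⟨k2, k3, k4, k5⟩
  -- Since `p₄ = 0`, the case `K = 0` means `R₁ = 0`, so the reality condition is available;
  -- conjugation then exchanges `l` and `n`.
  · have hp : L.p₃ = star L.p₂ := hR.resolve_left (by simpa [k4] using hK)
    have conj : star (c.a₃ * L.p₂ + c.a₂ * (c.A₅ - Complex.I * c.B₅))
        = c.a₂ * L.p₃ + c.a₃ * (c.A₅ + Complex.I * c.B₅) := by
      simp [hp, a₃]
    rcases h with h | h
    · exact ⟨h, by rw [← star_eq_zero, conj, h], k4, k5⟩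
    · exact ⟨by rw [← conj, h, star_zero], h, k4, k5⟩

/-- Positive dimension provides a prime that is not maximal; its quotient is a domain but not a
field. -/
theorem selfMotionParams_of_one_le {L : LegParams} (hR : L.R₁ ≠ 0 ∨ L.p₃ = star L.p₂)
    (hdim : 1 ≤ Motion.configDim (c.legConds L)) : c.SelfMotionParams L := by
  obtain ⟨Q, hQ, hQm⟩ : ∃ Q : Ideal (MvPolynomial MotionVar ℂ ⧸ Motion.configIdeal (c.legConds L)),
      Q.IsPrime ∧ ¬ Q.IsMaximal := by
    by_contra! hcon
    have h0 := Ring.KrullDimLE.mk₀ hcon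
    rw [Ring.krullDimLE_iff] at h0
    have := hdim.trans h0
    norm_num at this
  refine c.selfMotionParams_of_surjective hR
    (D := (MvPolynomial MotionVar ℂ ⧸ Motion.configIdeal (c.legConds L)) ⧸ Q)
    ((Ideal.Quotient.mkₐ ℂ Q).comp (Ideal.Quotient.mkₐ ℂ (Motion.configIdeal (c.legConds L))))
    ((Ideal.Quotient.mkₐ_surjective ℂ _).comp (Ideal.Quotient.mkₐ_surjective ℂ _))
    (fun h => hQm (Ideal.Quotient.maximal_of_isField Q h)) fun p hp => ?_
  have : Ideal.Quotient.mkₐ ℂ (Motion.configIdeal (c.legConds L)) p = 0 :=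
    Ideal.Quotient.eq_zero_iff_mem.2 hp
  rw [AlgHom.comp_apply, this, map_zero]

end Pentapod.Coordinatization

/-! ### Leg-replacement as linear algebra. -/

/-- Given bases `b` and `b'` of the same subspace, prescribing an affine-linear coefficient for the
members of `b` amounts to prescribing it for the members of `b'`. -/
theorem exists_span_eq_of_span_eq {ι V W : Type*} [AddCommGroup V] [Module ℂ V] [AddCommGroup W]
    [Module ℂ W] (b b' : ι → V) (hb : LinearIndependent ℂ b)
    (h : Submodule.span ℂ (Set.range b) = Submodule.span ℂ (Set.range b'))
    (T : V →ₗ[ℂ] W) (x : W) (k : ι → ℂ) :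
    ∃ k' : ι → ℂ, Submodule.span ℂ (Set.range fun i => T (b i) + k i • x)
      = Submodule.span ℂ (Set.range fun i => T (b' i) + k' i • x) := by
  -- The coefficients `k` extend to a functional `l` on `V`. Both families are then images under the
  -- single map `T + l(·) x`, which preserves equality of spans.
  obtain ⟨l, hl⟩ := LinearMap.exists_extend ((Module.Basis.span hb).constr ℂ k)
  have hl' : ∀ i, l (b i) = k i := fun i => by
    have h1 := LinearMap.congr_fun hl (Module.Basis.span hb i)
    rw [Module.Basis.constr_basis] at h1
    rw [← h1, LinearMap.comp_apply, Submodule.subtype_apply, Module.Basis.span_apply]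
  have key : ∀ c : ι → V, (Set.range fun i => T (c i) + l (c i) • x)
      = (T + l.smulRight x) '' Set.range c := fun c => by
    rw [← Set.range_comp]; rfl
  refine ⟨fun i => l (b' i), ?_⟩
  simp_rw [← hl']
  rw [key, key, ← Submodule.map_span, ← Submodule.map_span, h]

namespace Motion

/-- The part of a leg condition which does not depend on the leg parameter. -/
def legForm : Matrix (Fin 2) (Fin 4) ℂ →ₗ[ℂ] MvPolynomial MotionVar ℂ where
  toFun N := C (N 0 0) * (4 * n₀) + C (N 0 1) * y 1 + C (N 0 2) * y 2 + C (N 0 3) * y 3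
    + C (N 1 0) * y 0 + C (N 1 1) * x 1 + C (N 1 2) * x 2 + C (N 1 3) * x 3
  map_add' N N' := by simp only [Matrix.add_apply, C_add]; ring
  map_smul' r N := by
    simp only [Matrix.smul_apply, smul_eq_mul, C_mul, MvPolynomial.smul_eq_C_mul, RingHom.id_apply]
    ring

end Motion

namespace Pentapod

/-- The matrices of the five legs. -/
def legMatrix (𝕜 : Type*) [Field 𝕜] [Algebra ℝ 𝕜] (P : Pentapod) (i : Fin 5) :
    Matrix (Fin 2) (Fin 4) 𝕜 :=
  (vecMulVec ![1, P.a i] (homog (P.M i))).map (algebraMap ℝ 𝕜)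

theorem legSpan_eq (𝕜 : Type*) [Field 𝕜] [Algebra ℝ 𝕜] (P : Pentapod) :
    P.legSpan 𝕜 = Submodule.span 𝕜 (Set.range (P.legMatrix 𝕜)) := rfl

theorem sphereConds_eq (P : Pentapod) (R : Fin 5 → ℂ) (i : Fin 5) :
    P.sphereConds R i = Motion.legForm (P.legMatrix ℂ i)
      + (((P.a i : ℂ) ^ 2 + (P.M i 0 : ℂ) ^ 2 + (P.M i 1 : ℂ) ^ 2 + (P.M i 2 : ℂ) ^ 2
        - R i ^ 2) / 2) • Motion.x 0 := by
  simp [sphereConds, Motion.sphereCond, Motion.legForm, legMatrix, homog,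
    MvPolynomial.smul_eq_C_mul]
  ring

namespace Coordinatization

variable {P : Pentapod} (c : P.Coordinatization)

/-- The matrices of the replaced legs. -/
def replMatrix : Fin 5 → Matrix (Fin 2) (Fin 4) ℂ :=
  ![vecMulVec ![1, 0] ![1, 0, 0, 0], vecMulVec ![1, c.a₂] ![0, 1, -Complex.I, 0],
    vecMulVec ![1, c.a₃] ![0, 1, Complex.I, 0], vecMulVec ![1, 0] ![0, 0, 0, 1],
    vecMulVec ![0, 1] ![1, (c.A₅ : ℂ), (c.B₅ : ℂ), 0]]

theorem legConds_eq (L : LegParams) (i : Fin 5) :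
    c.legConds L i = Motion.legForm (c.replMatrix i)
      + (![-L.R₁ ^ 2 / 2, L.p₂, L.p₃, L.p₄, L.p₅] i) • Motion.x 0 := by
  fin_cases i <;>
  simp [legConds, replMatrix, Motion.sphereCond, Motion.darbouxCond, Motion.mannheimCond,
    Motion.legForm, MvPolynomial.smul_eq_C_mul] <;> ring

theorem replMatrix_mem (i : Fin 5) : c.replMatrix i ∈ c.pentapod.legSpan ℂ := by
  fin_cases i
  · exact c.leg₁
  · exact c.leg₂
  · exact c.leg₃
  · exact c.leg₄
  · exact c.leg₅

theorem linearIndependent_replMatrix : LinearIndependent ℂ c.replMatrix := by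
  rw [Fintype.linearIndependent_iff]
  intro g hg
  have e := fun i j => congrFun (congrFun hg i) j
  simp only [Fin.sum_univ_five, Matrix.add_apply, Matrix.smul_apply, replMatrix,
    Matrix.zero_apply] at e
  have h00 := e 0 0
  have h10 := e 1 0
  have h01 := e 0 1
  have h02 := e 0 2
  have h03 := e 0 3
  simp at h00 h10 h01 h02 h03
  have h1 : g 1 = 0 := by
    linear_combination h01 / 2 + Complex.I / 2 * h02 + (g 1 - g 2) / 2 * Complex.I_sq
  have h2 : g 2 = 0 := by linear_combination h01 - h1
  intro i
  fin_cases i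
  · exact h00
  · exact h1
  · exact h2
  · exact h03
  · exact h10

theorem span_replMatrix :
    Submodule.span ℂ (Set.range c.replMatrix) = c.pentapod.legSpan ℂ := by
  refine Submodule.eq_of_le_of_finrank_le ?_ ?_
  · rw [Submodule.span_le]
    rintro _ ⟨i, rfl⟩
    exact c.replMatrix_mem i
  · rw [finrank_span_eq_card c.linearIndependent_replMatrix]
    exact finrank_range_le_card (R := ℂ) (c.pentapod.legMatrix ℂ)

theorem linearIndependent_legMatrix : LinearIndependent ℂ (c.pentapod.legMatrix ℂ) := by
  rw [linearIndependent_iff_card_eq_finrank_span, Set.finrank, ← legSpan_eq, ← span_replMatrix,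
    finrank_span_eq_card c.linearIndependent_replMatrix]

/-- Every complex coefficient of `x₀` in a sphere condition is realized by some leg length, through
a complex square root. -/
theorem exists_legLengths (L : LegParams) : ∃ R : Fin 5 → ℂ, c.Replaces R L := by
  obtain ⟨k, hk⟩ := exists_span_eq_of_span_eq c.replMatrix (c.pentapod.legMatrix ℂ)
    c.linearIndependent_replMatrix c.span_replMatrix Motion.legForm (Motion.x 0)
    ![-L.R₁ ^ 2 / 2, L.p₂, L.p₃, L.p₄, L.p₅]
  choose R hR using fun i => IsAlgClosed.exists_pow_nat_eq
    ((c.pentapod.a i : ℂ) ^ 2 + (c.pentapod.M i 0 : ℂ) ^ 2 + (c.pentapod.M i 1 : ℂ) ^ 2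
      + (c.pentapod.M i 2 : ℂ) ^ 2 - 2 * k i) two_pos
  refine ⟨R, ?_⟩
  have hs : ∀ a b : ℂ, (a - (a - 2 * b)) / 2 = b := fun a b => by ring
  have h1 : c.pentapod.sphereConds R
      = fun i => Motion.legForm (c.pentapod.legMatrix ℂ i) + k i • Motion.x 0 := by
    funext i
    rw [sphereConds_eq, hR, hs]
  rw [Replaces, h1, funext (c.legConds_eq L)]
  exact hk.symm

theorem exists_legParams (R : Fin 5 → ℂ) : ∃ L : LegParams, c.Replaces R L := by
  obtain ⟨k, hk⟩ := exists_span_eq_of_span_eq (c.pentapod.legMatrix ℂ) c.replMatrix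
    c.linearIndependent_legMatrix c.span_replMatrix.symm Motion.legForm (Motion.x 0)
    (fun i => ((c.pentapod.a i : ℂ) ^ 2 + (c.pentapod.M i 0 : ℂ) ^ 2 + (c.pentapod.M i 1 : ℂ) ^ 2
      + (c.pentapod.M i 2 : ℂ) ^ 2 - R i ^ 2) / 2)
  obtain ⟨R₁, hR₁⟩ := IsAlgClosed.exists_pow_nat_eq (-2 * k 0) two_pos
  refine ⟨⟨R₁, k 1, k 2, k 3, k 4⟩, ?_⟩
  have h1 : c.legConds ⟨R₁, k 1, k 2, k 3, k 4⟩
      = fun i => Motion.legForm (c.replMatrix i) + k i • Motion.x 0 := by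
    funext i
    rw [legConds_eq]
    have : (![-R₁ ^ 2 / 2, k 1, k 2, k 3, k 4] : Fin 5 → ℂ) i = k i := by
      fin_cases i
      · change -R₁ ^ 2 / 2 = k 0
        rw [hR₁]; ring
      all_goals rfl
    rw [← this]
  rw [Replaces, h1, funext (c.pentapod.sphereConds_eq R)]
  exact hk

theorem existsUnique_selfMotionParams (R₁ : ℂ) :
    ∃! L : LegParams, L.R₁ = R₁ ∧ c.SelfMotionParams L := by
  have ha := c.a₂_ne_zero
  have hb := c.a₃_ne_zero
  refine ⟨⟨R₁, _, _, 0, (R₁ ^ 2 * (c.a₂ + c.a₃)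
    - ((c.A₅ : ℂ) ^ 2 + (c.B₅ : ℂ) ^ 2) * (c.a₂ + c.a₃)) / (2 * c.a₂ * c.a₃)⟩,
    ⟨rfl, rfl, rfl, rfl, ?_⟩, ?_⟩
  · dsimp only
    field_simp
    ring
  · rintro L ⟨h1, h2, h3, h4, h5⟩
    ext
    · exact h1
    · exact h2
    · exact h3
    · exact h4
    · rw [eq_div_iff (by simp [ha, hb]), ← h1]
      linear_combination h5

/-- The configuration ideal depends on the leg conditions only through their ℂ-span. -/
theorem configDim_eq_of_replaces {R : Fin 5 → ℂ} {L : LegParams} (h : c.Replaces R L) :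
    Motion.configDim (c.pentapod.sphereConds R) = Motion.configDim (c.legConds L) := by
  have key : ∀ F G : Fin 5 → MvPolynomial MotionVar ℂ,
      Submodule.span ℂ (Set.range F) ≤ Submodule.span ℂ (Set.range G) →
      Ideal.span (Set.range F) ≤ Ideal.span (Set.range G) := fun F G hFG => by
    rw [Ideal.span_le]
    rintro _ ⟨i, rfl⟩
    have h1 := hFG (Submodule.subset_span ⟨i, rfl⟩)
    exact Submodule.span_subset_span ℂ (MvPolynomial MotionVar ℂ) _ h1
  have : Motion.configIdeal (c.pentapod.sphereConds R) = Motion.configIdeal (c.legConds L) := by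
    simp only [Motion.configIdeal, Ideal.span_union]
    rw [le_antisymm (key _ _ h.le) (key _ _ h.ge)]
  rw [Motion.configDim, Motion.configDim, this]

end Coordinatization
end Pentapod

/-! ### Circular base points force a similarity. -/

theorem Matrix.ext_two_four {R : Type*} {N N' : Matrix (Fin 2) (Fin 4) R}
    (h₀ : N 0 0 = N' 0 0 ∧ N 0 1 = N' 0 1 ∧ N 0 2 = N' 0 2 ∧ N 0 3 = N' 0 3)
    (h₁ : N 1 0 = N' 1 0 ∧ N 1 1 = N' 1 1 ∧ N 1 2 = N' 1 2 ∧ N 1 3 = N' 1 3) : N = N' := by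
  obtain ⟨h00, h01, h02, h03⟩ := h₀
  obtain ⟨h10, h11, h12, h13⟩ := h₁
  ext i j
  fin_cases i <;> fin_cases j <;> assumption

/-- A five-dimensional space of legs which contains the legs of the platform point `0` with base
points on the third coordinate axis, and whose other legs have base points on a circle. -/
theorem exists_similarity (S : Submodule ℝ (Matrix (Fin 2) (Fin 4) ℝ))
    (hS : Module.finrank ℝ S = 5) (h13 : ∀ N ∈ S, N 1 3 = 0)
    (h0 : vecMulVec ![1, 0] ![1, 0, 0, 0] ∈ S)
    (hg : ∀ M : Fin 4 → ℝ, vecMulVec ![1, 0] M ∈ S → M 1 = 0 ∧ M 2 = 0)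
    {A B ρ : ℝ} (h5 : vecMulVec ![0, 1] ![1, A, B, 0] ∈ S) (hAB : A ≠ 0 ∨ B ≠ 0) (hρ : 0 < ρ)
    (hq : ∀ (s : ℝ) (M : Fin 4 → ℝ), M ≠ 0 → vecMulVec ![s, 1] M ∈ S →
      M 0 ≠ 0 ∧ M 1 ^ 2 + M 2 ^ 2 = 2 * ρ * M 1 * M 0) :
    ∃ a c : ℝ, c ≠ 0 ∧ !![0, a, -c, 0; 0, 1, 0, 0] ∈ S ∧ !![0, c, a, 0; 0, 0, 1, 0] ∈ S := by
  -- The omitted entries `N 0 1`, `N 0 2` are determined: a matrix in the kernel has zero second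
  -- row, so it is a leg of the platform point `0`, and `hg` applies.
  let π : S →ₗ[ℝ] (Fin 5 → ℝ) :=
    { toFun := fun N => ![N.1 1 0, N.1 1 1, N.1 1 2, N.1 0 0, N.1 0 3]
      map_add' := fun N N' => by ext i; fin_cases i <;> rfl
      map_smul' := fun r N => by ext i; fin_cases i <;> rfl }
  have hinj : Function.Injective π := by
    rw [injective_iff_map_eq_zero]
    rintro ⟨N, hN⟩ h
    have e := congrFun h
    have e0 : N 1 0 = 0 := e 0
    have e1 : N 1 1 = 0 := e 1
    have e2 : N 1 2 = 0 := e 2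
    have e3 : N 0 0 = 0 := e 3
    have e4 : N 0 3 = 0 := e 4
    have hN' : N = vecMulVec ![1, 0] (N 0) :=
      Matrix.ext_two_four (by simp only [vecMulVec_apply, Matrix.cons_val, one_mul, and_self])
        (by simp only [vecMulVec_apply, Matrix.cons_val, zero_mul, e0, e1, e2, h13 N hN, and_self])
    have h12 := hg (N 0) (hN' ▸ hN)
    refine Subtype.ext ?_
    exact Matrix.ext_two_four (by simp [e3, e4, h12]) (by simp [e0, e1, e2, h13 N hN])
  have hsurj : Function.Surjective π :=
    (LinearMap.injective_iff_surjective_of_finrank_eq_finrank (by simp [hS])).1 hinj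
  have hex : ∀ y : Fin 2 → ℝ, ∃ a b : ℝ, !![0, a, b, 0; 0, y 0, y 1, 0] ∈ S := fun y => by
    obtain ⟨⟨N, hN⟩, h⟩ := hsurj ![0, y 0, y 1, 0, 0]
    have e := congrFun h
    have e0 : N 1 0 = 0 := e 0
    have e1 : N 1 1 = y 0 := e 1
    have e2 : N 1 2 = y 1 := e 2
    have e3 : N 0 0 = 0 := e 3
    have e4 : N 0 3 = 0 := e 4
    refine ⟨N 0 1, N 0 2, ?_⟩
    convert hN using 1
    exact Matrix.ext_two_four (by simp [e3, e4]) (by simp [e0, e1, e2, h13 N hN])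
  -- This defines the linear map `E` with rows `(a, c)` and `(b, d)`: modulo the known legs, second
  -- row `y` goes with first row `E y`.
  obtain ⟨a, b, hN₁⟩ := hex ![1, 0]
  obtain ⟨c, d, hN₂⟩ := hex ![0, 1]
  simp only [Matrix.cons_val] at hN₁ hN₂
  have hleg : ∀ s v₀ v₁ v₂ : ℝ, s * v₁ = a * (v₁ - v₀ * A) + c * (v₂ - v₀ * B) →
      s * v₂ = b * (v₁ - v₀ * A) + d * (v₂ - v₀ * B) →
      vecMulVec ![s, 1] ![v₀, v₁, v₂, 0] ∈ S := fun s v₀ v₁ v₂ k1 k2 => by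
    have h := S.add_mem (S.add_mem (S.smul_mem v₀ h5) (S.smul_mem (s * v₀) h0))
      (S.add_mem (S.smul_mem (v₁ - v₀ * A) hN₁) (S.smul_mem (v₂ - v₀ * B) hN₂))
    convert h using 1
    exact Matrix.ext_two_four (by simp [k1, k2, mul_comm]) (by simp)
  -- If `E(A, B)` were zero, the ideal platform point `s = 0` would have the ideal base point `(0 :
  -- A : B : 0)`.
  have hw : a * A + c * B ≠ 0 ∨ b * A + d * B ≠ 0 := by
    by_contra! h
    have hv : (![0, A, B, 0] : Fin 4 → ℝ) ≠ 0 := fun h' => by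
      have k1 := congrFun h' 1
      have k2 := congrFun h' 2
      simp at k1 k2
      tauto
    refine (hq 0 _ hv (hleg 0 0 A B ?_ ?_)).1 rfl
    · linear_combination -h.1
    · linear_combination -h.2
  obtain ⟨w₁, hw₁⟩ : ∃ w, w = a * A + c * B := ⟨_, rfl⟩
  obtain ⟨w₂, hw₂⟩ : ∃ w, w = b * A + d * B := ⟨_, rfl⟩
  rw [← hw₁, ← hw₂] at hw
  -- With `w = E(A, B)`, Cramer's rule solves `(s - E)v = -v₀ w` by `v₀ = det(s - E)`, `v = -adj(s -
  -- E) w`. The circle equation becomes a polynomial identity in `s`.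
  have hid : ∀ s : ℝ, ((s - d) * w₁ + c * w₂) ^ 2 + (b * w₁ + (s - a) * w₂) ^ 2
      = -(2 * ρ * ((s - d) * w₁ + c * w₂) * ((s - a) * (s - d) - b * c)) := fun s => by
    have hmem := hleg s ((s - a) * (s - d) - b * c) (-((s - d) * w₁ + c * w₂))
      (-(b * w₁ + (s - a) * w₂)) (by rw [hw₁, hw₂]; ring) (by rw [hw₁, hw₂]; ring)
    by_cases hv : (![(s - a) * (s - d) - b * c, -((s - d) * w₁ + c * w₂),
        -(b * w₁ + (s - a) * w₂), 0] : Fin 4 → ℝ) = 0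
    · have k1 := congrFun hv 1
      have k2 := congrFun hv 2
      simp only [Matrix.cons_val, Pi.zero_apply, neg_eq_zero] at k1 k2
      rw [k1, k2]; ring
    · have := (hq s _ hv hmem).2
      simp only [Matrix.cons_val] at this
      linear_combination this
  -- Finite differences isolate coefficients: the values at `±1`, `±2` give that of `s³`, hence `w₁
  -- = 0`, and those at `0`, `±1` then give that of `s²`.
  have i0 := hid 0
  have i1 := hid 1
  have i2 := hid (-1)
  have i3 := hid 2
  have i4 := hid (-2)
  have k1 : w₁ = 0 := by
    have : ρ * w₁ = 0 := by
      linear_combination (-1/24) * i4 + (1/12) * i2 - (1/12) * i1 + (1/24) * i3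
    simpa [hρ.ne'] using this
  have hw₂0 : w₂ ≠ 0 := by simpa [k1] using hw
  subst k1
  have k2 : w₂ = -(2 * ρ * c) := by
    refine mul_left_cancel₀ hw₂0 ?_
    linear_combination (1/2) * i1 + (1/2) * i2 - i0
  have hc : c ≠ 0 := by
    rintro rfl
    exact hw₂0 (by simpa using k2)
  have hw' : w₂ ^ 2 ≠ 0 := pow_ne_zero 2 hw₂0
  -- After division by `w₂²` the identity reads `c² + (s - a)² = det(s - E)`, which makes `E` a
  -- similarity.
  have hid' : ∀ s : ℝ, c ^ 2 + (s - a) ^ 2 = (s - a) * (s - d) - b * c := fun s => by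
    refine mul_left_cancel₀ hw' ?_
    linear_combination hid s - w₂ * ((s - a) * (s - d) - b * c) * k2
  have k3 : d = a := by linear_combination hid' (a + 1) - hid' a
  have k4 : b = -c := by
    refine mul_right_cancel₀ hc ?_
    linear_combination hid' a
  exact ⟨a, c, hc, k4 ▸ hN₁, k3 ▸ hN₂⟩


/-! ### Change of Cartesian frames. -/

/-- The action of an affine map of the base space on homogeneous coordinates. -/
def homogMap (f : E3 →ᵃ[ℝ] E3) : (Fin 4 → ℝ) →ₗ[ℝ] (Fin 4 → ℝ) where
  toFun v := v 0 • homog (f 0) + idealDir (f.linear !₂[v 1, v 2, v 3])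
  map_add' v w := by
    have : (!₂[(v + w) 1, (v + w) 2, (v + w) 3] : E3) = !₂[v 1, v 2, v 3] + !₂[w 1, w 2, w 3] := by
      ext i; fin_cases i <;> rfl
    rw [this, map_add]
    ext i; fin_cases i <;> simp [homog, idealDir] <;> ring
  map_smul' r v := by
    have : (!₂[(r • v) 1, (r • v) 2, (r • v) 3] : E3) = r • !₂[v 1, v 2, v 3] := by
      ext i; fin_cases i <;> rfl
    rw [this, map_smul]
    ext i; fin_cases i <;> simp [homog, idealDir] <;> ring

theorem homogMap_apply (f : E3 →ᵃ[ℝ] E3) (v : Fin 4 → ℝ) :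
    homogMap f v = v 0 • homog (f 0) + idealDir (f.linear !₂[v 1, v 2, v 3]) := rfl

theorem homogMap_idealDir (f : E3 →ᵃ[ℝ] E3) (n : E3) :
    homogMap f (idealDir n) = idealDir (f.linear n) := by
  have : (!₂[n 0, n 1, n 2] : E3) = n := by ext i; fin_cases i <;> rfl
  rw [homogMap_apply]
  change (0 : ℝ) • _ + idealDir (f.linear !₂[n 0, n 1, n 2]) = _
  rw [this, zero_smul, zero_add]

theorem homogMap_homog (f : E3 →ᵃ[ℝ] E3) (X : E3) : homogMap f (homog X) = homog (f X) := by
  have h1 : (!₂[X 0, X 1, X 2] : E3) = X := by ext i; fin_cases i <;> rfl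
  have h2 : f X = f.linear X + f 0 := by
    have := f.map_vadd 0 X
    simpa using this
  rw [homogMap_apply]
  change (1 : ℝ) • _ + idealDir (f.linear !₂[X 0, X 1, X 2]) = _
  rw [h1, h2]
  ext i; fin_cases i <;> simp [homog, idealDir, add_comm]

theorem eq_homog_add_idealDir (v : Fin 4 → ℝ) :
    v = v 0 • homog 0 + idealDir !₂[v 1, v 2, v 3] := by
  ext i; fin_cases i <;> simp [homog, idealDir]

theorem homogMap_homogMap (f g : E3 →ᵃ[ℝ] E3) (v : Fin 4 → ℝ) :
    homogMap f (homogMap g v) = homogMap (f.comp g) v := by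
  rw [eq_homog_add_idealDir v]
  simp only [map_add, map_smul, homogMap_homog, homogMap_idealDir]
  rfl

theorem homogMap_id (v : Fin 4 → ℝ) : homogMap (AffineMap.id ℝ E3) v = v := by
  conv_rhs => rw [eq_homog_add_idealDir v]
  rfl

/-- The action of an affine map of the platform line on homogeneous coordinates. -/
def platMap (f : ℝ →ᵃ[ℝ] ℝ) : (Fin 2 → ℝ) →ₗ[ℝ] (Fin 2 → ℝ) where
  toFun v := ![v 0, v 0 * f 0 + f.linear (v 1)]
  map_add' v w := by ext i; fin_cases i <;> simp; ring
  map_smul' r v := by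
    have h : f.linear (r * v 1) = r * f.linear (v 1) := map_smul f.linear r (v 1)
    ext i; fin_cases i <;> simp [h]; ring

theorem platMap_apply (f : ℝ →ᵃ[ℝ] ℝ) (v : Fin 2 → ℝ) :
    platMap f v = ![v 0, v 0 * f 0 + f.linear (v 1)] := rfl

theorem platMap_one (f : ℝ →ᵃ[ℝ] ℝ) (a : ℝ) : platMap f ![1, a] = ![1, f a] := by
  have h2 : f a = f.linear a + f 0 := by
    have := f.map_vadd 0 a
    simpa using this
  rw [platMap_apply, h2]
  ext i; fin_cases i <;> simp [add_comm]

/-- The action of a pair of affine maps on the matrices of legs. -/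
def legMap (f : E3 →ᵃ[ℝ] E3) (g : ℝ →ᵃ[ℝ] ℝ) :
    Matrix (Fin 2) (Fin 4) ℝ →ₗ[ℝ] Matrix (Fin 2) (Fin 4) ℝ where
  toFun N := LinearMap.toMatrix' (platMap g) * N * (LinearMap.toMatrix' (homogMap f))ᵀ
  map_add' N N' := by rw [Matrix.mul_add, Matrix.add_mul]
  map_smul' r N := by simp

theorem legMap_vecMulVec (f : E3 →ᵃ[ℝ] E3) (g : ℝ →ᵃ[ℝ] ℝ) (m : Fin 2 → ℝ) (M : Fin 4 → ℝ) :
    legMap f g (vecMulVec m M) = vecMulVec (platMap g m) (homogMap f M) := by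
  change LinearMap.toMatrix' (platMap g) * vecMulVec m M * (LinearMap.toMatrix' (homogMap f))ᵀ = _
  rw [mul_vecMulVec, vecMulVec_mul, vecMul_transpose, LinearMap.toMatrix'_mulVec,
    LinearMap.toMatrix'_mulVec]

namespace Pentapod

theorem legMatrix_real (P : Pentapod) (i : Fin 5) :
    P.legMatrix ℝ i = vecMulVec ![1, P.a i] (homog (P.M i)) := by
  ext; rfl

theorem legMap_mem (P : Pentapod) (base : E3 ≃ᵃⁱ[ℝ] E3) (plat : ℝ ≃ᵃⁱ[ℝ] ℝ)
    {N : Matrix (Fin 2) (Fin 4) ℝ} (hN : N ∈ P.legSpan ℝ) :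
    legMap base.toAffineEquiv plat.toAffineEquiv N ∈ (P.inFrames base plat).legSpan ℝ := by
  have : P.legSpan ℝ ≤ ((P.inFrames base plat).legSpan ℝ).comap
      (legMap base.toAffineEquiv plat.toAffineEquiv) := by
    rw [legSpan_eq, Submodule.span_le]
    rintro _ ⟨i, rfl⟩
    refine Submodule.subset_span ⟨i, ?_⟩
    change legMatrix ℝ (P.inFrames base plat) i = _
    rw [legMatrix_real, legMatrix_real, legMap_vecMulVec, platMap_one, homogMap_homog]
    rfl
  exact this hN

theorem inFrames_symm (P : Pentapod) (base : E3 ≃ᵃⁱ[ℝ] E3) (plat : ℝ ≃ᵃⁱ[ℝ] ℝ) :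
    (P.inFrames base plat).inFrames base.symm plat.symm = P := by
  simp [inFrames]

/-- The inverse frame change maps the new span onto the old one. This inequality is enough, as five
legs span at most five dimensions. -/
theorem finrank_legSpan_inFrames (P : Pentapod) (base : E3 ≃ᵃⁱ[ℝ] E3) (plat : ℝ ≃ᵃⁱ[ℝ] ℝ) :
    Module.finrank ℝ (P.legSpan ℝ) ≤ Module.finrank ℝ ((P.inFrames base plat).legSpan ℝ) := by
  refine le_trans (Submodule.finrank_mono ?_) (Submodule.finrank_map_le
    (legMap base.symm.toAffineEquiv plat.symm.toAffineEquiv) _)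
  rw [legSpan_eq, Submodule.span_le]
  rintro _ ⟨i, rfl⟩
  refine ⟨(P.inFrames base plat).legMatrix ℝ i, Submodule.subset_span ⟨i, rfl⟩, ?_⟩
  rw [legMatrix_real, legMatrix_real, legMap_vecMulVec, platMap_one, homogMap_homog]
  change vecMulVec ![1, plat.symm (plat (P.a i))] (homog (base.symm (base (P.M i)))) = _
  rw [plat.symm_apply_apply, base.symm_apply_apply]

/-! ### Rank of the leg span and the correspondence of Type 2. -/

/-- The Plücker coordinates of a leg in the pose which takes the points with coordinates `0` and
`1` of the platform line to `s` and `s + t`. -/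
def plueckerMap (s t : Fin 3 → ℝ) : Matrix (Fin 2) (Fin 4) ℝ →ₗ[ℝ] (Fin 3 ⊕ Fin 3 → ℝ) where
  toFun N := Sum.elim (fun j => N 0 0 * s j + N 1 0 * t j - N 0 j.succ)
    (crossProduct (fun j => N 0 j.succ) s + crossProduct (fun j => N 1 j.succ) t)
  map_add' N N' := by
    ext (j | j)
    · simp only [Sum.elim_inl, Pi.add_apply, Matrix.add_apply]; ring
    · fin_cases j <;> simp [cross_apply] <;> ring
  map_smul' r N := by
    ext (j | j)
    · simp only [Sum.elim_inl, Pi.smul_apply, Matrix.smul_apply, smul_eq_mul, RingHom.id_apply]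
      ring
    · fin_cases j <;> simp [cross_apply] <;> ring

/-- In a fixed pose the Plücker coordinates of a leg are linear in its matrix, so the rank of the
Jacobian never exceeds the dimension of the span. -/
theorem finrank_legSpan (P : Pentapod) (hP : ¬ P.IsArchitecturallySingular) :
    Module.finrank ℝ (P.legSpan ℝ) = 5 := by
  apply le_antisymm
  · exact finrank_range_le_card (R := ℝ) (P.legMatrix ℝ)
  · by_contra! hlt
    refine hP fun φ => lt_of_le_of_lt ?_ hlt
    rw [Matrix.rank_eq_finrank_span_row]
    refine le_trans (Submodule.finrank_mono ?_)
      (Submodule.finrank_map_le (plueckerMap (φ 0).ofLp (φ.linear 1).ofLp) _)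
    rw [Submodule.span_le]
    rintro _ ⟨i, rfl⟩
    refine ⟨P.legMatrix ℝ i, Submodule.subset_span ⟨i, rfl⟩, ?_⟩
    have h2 : φ (P.a i) = P.a i • φ.linear 1 + φ 0 := by
      have := φ.toAffineMap.map_vadd 0 (P.a i)
      rw [← map_smul]
      simpa using this
    rw [legMatrix_real]
    change _ = Sum.elim (φ (P.a i) - P.M i).ofLp
      (crossProduct (P.M i).ofLp (φ (P.a i) - P.M i).ofLp)
    rw [h2]
    ext (j | j) <;> fin_cases j <;>
      simp [plueckerMap, cross_apply, homog] <;> ring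

theorem corr_mk (P : Pentapod) {m : Fin 2 → ℝ} {M : Fin 4 → ℝ} (hm : m ≠ 0) (hM : M ≠ 0) :
    P.Corr (.mk ℝ m hm) (.mk ℝ M hM) ↔ vecMulVec m M ∈ P.legSpan ℝ := by
  obtain ⟨a, ha⟩ := Projectivization.exists_smul_eq_mk_rep ℝ m hm
  obtain ⟨b, hb⟩ := Projectivization.exists_smul_eq_mk_rep ℝ M hM
  rw [Corr, ← ha, ← hb, Units.smul_def, Units.smul_def, vecMulVec_smul, smul_vecMulVec,
    Submodule.smul_mem_iff _ b.ne_zero, Submodule.smul_mem_iff _ a.ne_zero]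

namespace TypeTwo

variable {P : Pentapod} (T : P.TypeTwo)

theorem vecMulVec_mem_iff {M : Fin 4 → ℝ} (hM : M ≠ 0) :
    vecMulVec ![1, T.P₁] M ∈ P.legSpan ℝ ↔ M ∈ T.g := by
  obtain ⟨b, hb⟩ := Projectivization.exists_smul_eq_mk_rep ℝ M hM
  rw [← corr_mk P (platPoint_ne_zero _) hM, T.corr_iff, ← hb, Units.smul_def,
    Submodule.smul_mem_iff _ b.ne_zero]
  simp

theorem mk_ne {m : Fin 2 → ℝ} (hm : m ≠ 0) (h : m 1 ≠ T.P₁ * m 0) :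
    (.mk ℝ m hm : PlatLine) ≠ .mk ℝ ![1, T.P₁] (platPoint_ne_zero T.P₁) := by
  intro he
  rw [Projectivization.mk_eq_mk_iff'] at he
  obtain ⟨r, rfl⟩ := he
  apply h
  simp [mul_comm]

theorem mem_q_of_mem {m : Fin 2 → ℝ} {M : Fin 4 → ℝ} (h : m 1 ≠ T.P₁ * m 0) (hM : M ≠ 0)
    (hmM : vecMulVec m M ∈ P.legSpan ℝ) : .mk ℝ M hM ∈ T.q ∧ .mk ℝ M hM ≠ T.Q := by
  have hm : m ≠ 0 := by rintro rfl; simp at h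
  rw [← corr_mk P hm hM, T.corr_iff] at hmM
  rcases hmM with ⟨h1, -⟩ | ⟨h1, h2⟩
  · exact absurd h1 (T.mk_ne hm h)
  · rw [h2]
    exact (T.σ ⟨_, h1⟩).2

theorem exists_mem_q {m : Fin 2 → ℝ} (h : m 1 ≠ T.P₁ * m 0) :
    ∃ M : BaseSpace, M ∈ T.q ∧ M ≠ T.Q ∧ vecMulVec m M.rep ∈ P.legSpan ℝ := by
  have hm : m ≠ 0 := by rintro rfl; simp at h
  have h1 := T.mk_ne hm h
  refine ⟨T.σ ⟨_, h1⟩, (T.σ ⟨_, h1⟩).2.1, (T.σ ⟨_, h1⟩).2.2, ?_⟩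
  rw [← corr_mk P hm (Projectivization.rep_nonzero _), Projectivization.mk_rep, T.corr_iff]
  exact Or.inr ⟨h1, rfl⟩

end TypeTwo
end Pentapod

/-! ### Construction of the special frames. -/

/-- A Cartesian frame with origin on a given circle, whose center is on the first axis and whose
axis is parallel to the third axis. -/
theorem exists_circle_frame {c n X₀ : E3} {ρ : ℝ} (hρ : 0 < ρ) (hn : n ≠ 0)
    (h₁ : inner ℝ n (X₀ - c) = 0) (h₂ : dist X₀ c = ρ) :
    ∃ base : E3 ≃ᵃⁱ[ℝ] E3, base X₀ = 0 ∧ base c = !₂[ρ, 0, 0] ∧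
      ∃ k : ℝ, k ≠ 0 ∧ base.linearIsometryEquiv n = !₂[0, 0, k] := by
  have hn' : ‖n‖ ≠ 0 := norm_ne_zero_iff.2 hn
  have hcd : ‖c - X₀‖ = ρ := by rw [← h₂, dist_comm, dist_eq_norm]
  have hin : inner ℝ n (c - X₀) = 0 := by
    rw [← neg_sub, inner_neg_right, h₁, neg_zero]
  have e₁ : ‖ρ⁻¹ • (c - X₀)‖ = 1 := by
    rw [norm_smul, norm_inv, Real.norm_of_nonneg hρ.le, hcd, inv_mul_cancel₀ hρ.ne']
  have e₂ : ‖‖n‖⁻¹ • n‖ = 1 := by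
    rw [norm_smul, norm_inv, norm_norm, inv_mul_cancel₀ hn']
  obtain ⟨b, hb⟩ := Orthonormal.exists_orthonormalBasis_extension_of_card_eq (𝕜 := ℝ) (E := E3)
    (ι := Fin 3) (by simp) (v := ![ρ⁻¹ • (c - X₀), 0, ‖n‖⁻¹ • n]) (s := {0, 2}) (by
      rw [orthonormal_iff_ite]
      rintro ⟨i, rfl | rfl⟩ ⟨j, rfl | rfl⟩
      · simp [e₁]
      · simp [real_inner_smul_right, real_inner_comm, hin, Subtype.ext_iff]
      · simp [real_inner_smul_left, real_inner_smul_right, hin, Subtype.ext_iff]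
      · simp [e₂])
  have hb0 : b 0 = ρ⁻¹ • (c - X₀) := hb 0 (by simp)
  have hb2 : b 2 = ‖n‖⁻¹ • n := hb 2 (by simp)
  have hc : c - X₀ = ρ • b 0 := by rw [hb0, smul_inv_smul₀ hρ.ne']
  have hn2 : n = ‖n‖ • b 2 := by rw [hb2, smul_inv_smul₀ hn']
  refine ⟨(AffineIsometryEquiv.vaddConst ℝ X₀).symm.trans b.repr.toAffineIsometryEquiv,
    ?_, ?_, ‖n‖, hn', ?_⟩
  · simp
  · change b.repr (c - X₀) = _
    rw [hc, map_smul, b.repr_self]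
    ext i; fin_cases i <;> simp
  · change b.repr n = _
    conv_lhs => rw [hn2]
    rw [map_smul, b.repr_self]
    ext i; fin_cases i <;> simp

theorem homog_smul_injective {X Y : E3} {r : ℝ} (h : r • homog Y = homog X) : X = Y := by
  have h0 : r = 1 := by simpa [homog] using congrFun h 0
  rw [h0, one_smul] at h
  have h1 : Y 0 = X 0 := congrFun h 1
  have h2 : Y 1 = X 1 := congrFun h 2
  have h3 : Y 2 = X 2 := congrFun h 3
  ext i; fin_cases i
  · exact h1.symm
  · exact h2.symm
  · exact h3.symm

theorem exists_eq_homog_add_idealDir {g : Submodule ℝ (Fin 4 → ℝ)} (hg : Module.finrank ℝ g = 2)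
    {X n : E3} (hX : homog X ∈ g) (hn : idealDir n ∈ g) (hn₀ : n ≠ 0) {M : Fin 4 → ℝ}
    (hM : M ∈ g) : ∃ α β : ℝ, M = α • homog X + β • idealDir n := by
  have hli : LinearIndependent ℝ ![homog X, idealDir n] := by
    rw [LinearIndependent.pair_iff]
    intro s t hst
    have hs : s = 0 := by simpa [homog, idealDir] using congrFun hst 0
    refine ⟨hs, ?_⟩
    by_contra ht
    apply hn₀
    rw [hs, zero_smul, zero_add, smul_eq_zero, or_iff_right ht] at hst
    have h1 : n 0 = 0 := congrFun hst 1
    have h2 : n 1 = 0 := congrFun hst 2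
    have h3 : n 2 = 0 := congrFun hst 3
    ext i; fin_cases i
    · exact h1
    · exact h2
    · exact h3
  have hspan : Submodule.span ℝ (Set.range ![homog X, idealDir n]) = g := by
    refine Submodule.eq_of_le_of_finrank_le ?_ ?_
    · rw [Submodule.span_le]
      rintro _ ⟨i, rfl⟩
      fin_cases i
      · exact hX
      · exact hn
    · rw [finrank_span_eq_card hli, hg]; simp
  rw [← hspan, Matrix.range_cons, Matrix.range_cons, Matrix.range_empty, Set.union_empty,
    Set.singleton_union, Submodule.mem_span_pair] at hM
  obtain ⟨α, β, h⟩ := hM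
  exact ⟨α, β, h.symm⟩

namespace Pentapod

theorem map_mem_legSpan (P : Pentapod) {N : Matrix (Fin 2) (Fin 4) ℝ} (hN : N ∈ P.legSpan ℝ) :
    N.map (algebraMap ℝ ℂ) ∈ P.legSpan ℂ := by
  rw [legSpan_eq] at hN
  induction hN using Submodule.span_induction with
  | mem N h =>
    obtain ⟨i, rfl⟩ := h
    exact Submodule.subset_span ⟨i, by rw [legMatrix_real]⟩
  | zero => rw [Matrix.map_zero _ (map_zero _)]; exact Submodule.zero_mem _
  | add N N' _ _ h h' => rw [Matrix.map_add _ (map_add _)]; exact Submodule.add_mem _ h h'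
  | smul r N _ h =>
    have : (r • N).map (algebraMap ℝ ℂ) = (r : ℂ) • N.map (algebraMap ℝ ℂ) := by ext i j; simp
    rw [this]
    exact Submodule.smul_mem _ _ h

/-- The coordinatization which belongs to frames in which the legs at infinity are given by a
similarity. -/
theorem nonempty_coordinatization_of_frame {P : Pentapod} (base : E3 ≃ᵃⁱ[ℝ] E3)
    (plat : ℝ ≃ᵃⁱ[ℝ] ℝ) {A B a c : ℝ} (hAB : A ≠ 0 ∨ B ≠ 0) (hc : c ≠ 0)
    (h₁ : vecMulVec ![1, 0] ![1, 0, 0, 0] ∈ (P.inFrames base plat).legSpan ℝ)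
    (h₄ : vecMulVec ![1, 0] ![0, 0, 0, 1] ∈ (P.inFrames base plat).legSpan ℝ)
    (h₅ : vecMulVec ![0, 1] ![1, A, B, 0] ∈ (P.inFrames base plat).legSpan ℝ)
    (hN₁ : !![0, a, -c, 0; 0, 1, 0, 0] ∈ (P.inFrames base plat).legSpan ℝ)
    (hN₂ : !![0, c, a, 0; 0, 0, 1, 0] ∈ (P.inFrames base plat).legSpan ℝ) :
    Nonempty P.Coordinatization := by
  have i2 := Complex.I_mul_I
  have hs : (a : ℂ) - c * Complex.I ≠ 0 := fun h => hc (by simpa using congrArg Complex.im h)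
  have hs' : (a : ℂ) + c * Complex.I ≠ 0 := fun h => hc (by simpa using congrArg Complex.im h)
  have hstar : star (((a : ℂ) - c * Complex.I)⁻¹) = ((a : ℂ) + c * Complex.I)⁻¹ := by
    simp
  -- `(1, -i)` and `(1, i)` are eigenvectors of the similarity with eigenvalues `a - ic` and `a +
  -- ic`. Hence `N₁ - iN₂` and `N₁ + iN₂` have rank one, and `a₂` is the inverse of the first
  -- eigenvalue.
  refine ⟨⟨base, plat, ((a : ℂ) - c * Complex.I)⁻¹, A, B, ?_, hAB, ?_, ?_, ?_, ?_, ?_⟩⟩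
  · rw [Complex.inv_im]
    have : Complex.normSq ((a : ℂ) - c * Complex.I) ≠ 0 := by simpa using hs
    simp [hc] at this ⊢
    exact this
  · convert map_mem_legSpan _ h₁ using 1
    exact Matrix.ext_two_four (by simp) (by simp)
  · have h := Submodule.smul_mem _ (((a : ℂ) - c * Complex.I)⁻¹) (Submodule.add_mem _
      (map_mem_legSpan _ hN₁) (Submodule.smul_mem _ (-Complex.I) (map_mem_legSpan _ hN₂)))
    convert h using 1
    refine Matrix.ext_two_four ?_ (by simp)
    simp
    rw [eq_inv_mul_iff_mul_eq₀ hs, eq_inv_mul_iff_mul_eq₀ hs]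
    exact ⟨by ring, by linear_combination (c : ℂ) * i2⟩
  · have h := Submodule.smul_mem _ (((a : ℂ) + c * Complex.I)⁻¹) (Submodule.add_mem _
      (map_mem_legSpan _ hN₁) (Submodule.smul_mem _ Complex.I (map_mem_legSpan _ hN₂)))
    rw [hstar]
    convert h using 1
    refine Matrix.ext_two_four ?_ (by simp)
    simp
    rw [eq_inv_mul_iff_mul_eq₀ hs', eq_inv_mul_iff_mul_eq₀ hs']
    exact ⟨by ring, by linear_combination (c : ℂ) * i2⟩
  · convert map_mem_legSpan _ h₄ using 1
    exact Matrix.ext_two_four (by simp) (by simp)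
  · convert map_mem_legSpan _ h₅ using 1
    exact Matrix.ext_two_four (by simp) (by simp)

end Pentapod

namespace Pentapod

theorem legMap_vecMulVec_mem {P : Pentapod} (base : E3 ≃ᵃⁱ[ℝ] E3) (plat : ℝ ≃ᵃⁱ[ℝ] ℝ)
    {m : Fin 2 → ℝ} {M : Fin 4 → ℝ} (h : vecMulVec m M ∈ P.legSpan ℝ) :
    vecMulVec (platMap plat.toAffineEquiv m) (homogMap base.toAffineEquiv M)
      ∈ (P.inFrames base plat).legSpan ℝ := by
  have := P.legMap_mem base plat h
  rwa [legMap_vecMulVec] at this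

theorem exists_vecMulVec_mem {P : Pentapod} (base : E3 ≃ᵃⁱ[ℝ] E3) (plat : ℝ ≃ᵃⁱ[ℝ] ℝ)
    {m : Fin 2 → ℝ} {M : Fin 4 → ℝ} (h : vecMulVec m M ∈ (P.inFrames base plat).legSpan ℝ) :
    ∃ M' : Fin 4 → ℝ, M = homogMap base.toAffineEquiv M' ∧
      vecMulVec (platMap plat.symm.toAffineEquiv m) M' ∈ P.legSpan ℝ := by
  have h1 := legMap_vecMulVec_mem base.symm plat.symm h
  rw [inFrames_symm] at h1
  refine ⟨_, ?_, h1⟩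
  rw [homogMap_homogMap]
  have : (base.toAffineEquiv : E3 →ᵃ[ℝ] E3).comp (base.symm.toAffineEquiv : E3 →ᵃ[ℝ] E3)
      = AffineMap.id ℝ E3 := by
    ext1 X
    exact base.apply_symm_apply X
  rw [this, homogMap_id]

/-- With `Q` as origin, the center of the circle on the first axis and `P₁` as platform origin, the
Duporcq condition makes `g` the third axis, which is the situation of `exists_similarity`. -/
theorem TypeTwo.nonempty_coordinatization {P : Pentapod} (hP : ¬ P.IsArchitecturallySingular)
    (T : P.TypeTwo) (hD : T.Duporcq) : Nonempty P.Coordinatization := by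
  obtain ⟨c, n, ρ, hρ, hn, hq, hng⟩ := hD
  obtain ⟨X₀, h1, h2, hX₀⟩ : T.Q ∈ {M | ∃ X : E3, inner ℝ n (X - c) = 0 ∧ dist X c = ρ ∧
      M = .mk ℝ (homog X) (homog_ne_zero X)} := hq ▸ T.Q_mem_q
  have hX₀g : homog X₀ ∈ T.g := by
    obtain ⟨a, ha⟩ := Projectivization.exists_smul_eq_mk_rep ℝ (homog X₀) (homog_ne_zero X₀)
    have := T.Q_mem_g
    rwa [hX₀, ← ha, Units.smul_def, Submodule.smul_mem_iff _ a.ne_zero] at this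
  obtain ⟨base, hb₀, hbc, k, hk, hbn⟩ := exists_circle_frame hρ hn h1 h2
  let plat : ℝ ≃ᵃⁱ[ℝ] ℝ := (AffineIsometryEquiv.vaddConst ℝ T.P₁).symm
  have hplat : ∀ x, plat x = x - T.P₁ := fun _ => rfl
  have hplat' : ∀ m : Fin 2 → ℝ, platMap plat.toAffineEquiv m = ![m 0, m 1 - T.P₁ * m 0] :=
    fun m => by
      change ![m 0, m 0 * (0 - T.P₁) + m 1] = _
      congr 2; ring
  have hplat'' : ∀ m : Fin 2 → ℝ,
      platMap plat.symm.toAffineEquiv m = ![m 0, m 1 + T.P₁ * m 0] := fun m => by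
    change ![m 0, m 0 * (0 + T.P₁) + m 1] = _
    congr 2; ring
  have hbn' : idealDir (base.linearIsometryEquiv n) = k • ![0, 0, 0, 1] := by
    rw [hbn]; ext i; fin_cases i <;> simp [idealDir]
  have hhom : ∀ X, homogMap base.toAffineEquiv (homog X) = homog (base X) :=
    fun X => homogMap_homog _ X
  have hide : homogMap base.toAffineEquiv (idealDir n) = k • ![0, 0, 0, 1] := by
    rw [homogMap_idealDir, ← hbn']; rfl
  have hcirc : ∀ X : E3, inner ℝ n (X - c) = 0 → dist X c = ρ →
      base X 2 = 0 ∧ base X 0 ^ 2 + base X 1 ^ 2 = 2 * ρ * base X 0 := fun X e1 e2 => by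
    have e3 : base X 2 = 0 := by
      rw [← base.linearIsometryEquiv.inner_map_map, hbn] at e1
      have : base.linearIsometryEquiv (X - c) = base X - base c := base.map_vsub X c
      rw [this, hbc] at e1
      simpa [EuclideanSpace.inner_eq_star_dotProduct, dotProduct, Fin.sum_univ_three, hk] using e1
    refine ⟨e3, ?_⟩
    rw [← base.dist_map, hbc, EuclideanSpace.dist_eq, Real.sqrt_eq_iff_mul_self_eq_of_pos hρ] at e2
    simp [Fin.sum_univ_three, Real.dist_eq, e3] at e2
    linear_combination -e2
  have hmem : ∀ {m : Fin 2 → ℝ} {M : Fin 4 → ℝ}, m 1 ≠ T.P₁ * m 0 → M ≠ 0 →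
      vecMulVec m M ∈ P.legSpan ℝ → ∃ X : E3, ∃ r : ℝ, M = r • homog X ∧
        base X 2 = 0 ∧ base X 0 ^ 2 + base X 1 ^ 2 = 2 * ρ * base X 0 := fun h hM hmM => by
    obtain ⟨h3, -⟩ := T.mem_q_of_mem h hM hmM
    rw [hq] at h3
    obtain ⟨X, e1, e2, e3⟩ := h3
    rw [Projectivization.mk_eq_mk_iff'] at e3
    obtain ⟨r, hr⟩ := e3
    exact ⟨X, r, hr.symm, hcirc X e1 e2⟩
  have hg : ∀ {M : Fin 4 → ℝ}, M ∈ T.g →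
      vecMulVec ![1, 0] (homogMap base.toAffineEquiv M) ∈ (P.inFrames base plat).legSpan ℝ :=
    fun {M} hM => by
      have h3 : vecMulVec ![1, T.P₁] M ∈ P.legSpan ℝ := by
        by_cases hM0 : M = 0
        · have : vecMulVec ![1, T.P₁] M = 0 := by
            ext i j; simp only [hM0, vecMulVec_apply, Pi.zero_apply, mul_zero, Matrix.zero_apply]
          rw [this]; exact Submodule.zero_mem _
        · exact (T.vecMulVec_mem_iff hM0).2 hM
      have h4 := legMap_vecMulVec_mem base plat h3
      rw [hplat'] at h4
      simpa using h4
  have leg₁ : vecMulVec ![1, 0] ![1, 0, 0, 0] ∈ (P.inFrames base plat).legSpan ℝ := by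
    have := hg hX₀g
    rwa [hhom, hb₀] at this
  have leg₄ : vecMulVec ![1, 0] ![0, 0, 0, 1] ∈ (P.inFrames base plat).legSpan ℝ := by
    have := hg hng
    rwa [hide, vecMulVec_smul, Submodule.smul_mem_iff _ hk] at this
  -- The fifth leg belongs to the ideal platform point. Its base point is on the circle but is not
  -- `Q`, whence `(A₅, B₅) ≠ 0`.
  obtain ⟨Mi, hMiq, hMiQ, hMi⟩ := T.exists_mem_q (m := ![0, 1]) (by simp)
  rw [hq] at hMiq
  obtain ⟨X₅, f1, f2, f3⟩ := hMiq
  have leg₅ : vecMulVec ![0, 1] ![1, base X₅ 0, base X₅ 1, 0]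
      ∈ (P.inFrames base plat).legSpan ℝ := by
    obtain ⟨a, ha⟩ := Projectivization.exists_smul_eq_mk_rep ℝ (homog X₅) (homog_ne_zero X₅)
    rw [f3, ← ha, Units.smul_def, vecMulVec_smul, Submodule.smul_mem_iff _ a.ne_zero] at hMi
    have := legMap_vecMulVec_mem base plat hMi
    rw [hplat', hhom, homog, (hcirc X₅ f1 f2).1] at this
    simpa using this
  have hAB : base X₅ 0 ≠ 0 ∨ base X₅ 1 ≠ 0 := by
    by_contra! h
    have : base X₅ = base X₀ := by
      rw [hb₀]
      ext i; fin_cases i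
      · exact h.1
      · exact h.2
      · exact (hcirc X₅ f1 f2).1
    apply hMiQ
    rw [f3, hX₀, base.injective this]
  have hfin : Module.finrank ℝ ((P.inFrames base plat).legSpan ℝ) = 5 :=
    le_antisymm (finrank_range_le_card (R := ℝ) ((P.inFrames base plat).legMatrix ℝ))
      ((P.finrank_legSpan hP).ge.trans (P.finrank_legSpan_inFrames base plat))
  -- For an original leg this entry is `a_j C_j`: either the platform anchor is `P₁`, now the
  -- origin, or the base anchor lies in the plane of the circle.
  have h13 : ∀ N ∈ (P.inFrames base plat).legSpan ℝ, N 1 3 = 0 := by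
    have : (P.inFrames base plat).legSpan ℝ ≤ LinearMap.ker (Matrix.entryLinearMap ℝ ℝ 1 3) := by
      rw [legSpan_eq, Submodule.span_le]
      rintro _ ⟨i, rfl⟩
      change (P.inFrames base plat).legMatrix ℝ i 1 3 = 0
      rw [legMatrix_real, vecMulVec_apply]
      change plat (P.a i) * base (P.M i) 2 = 0
      by_cases ha : P.a i = T.P₁
      · rw [hplat, ha, sub_self, zero_mul]
      · obtain ⟨X, r, hr, h2, -⟩ := hmem (m := ![1, P.a i]) (M := homog (P.M i))
          (by simpa using ha) (homog_ne_zero _)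
          (Submodule.subset_span ⟨i, P.legMatrix_real i⟩)
        rw [homog_smul_injective hr.symm, h2, mul_zero]
    exact fun N hN => this hN
  obtain ⟨a, c, hc, hN₁, hN₂⟩ := exists_similarity _ hfin h13 leg₁ (fun M hM => by
      obtain ⟨M', rfl, hM'⟩ := exists_vecMulVec_mem base plat hM
      rw [hplat''] at hM'
      have hM'g : M' ∈ T.g := by
        by_cases h0 : M' = 0
        · rw [h0]; exact T.g.zero_mem
        · exact (T.vecMulVec_mem_iff h0).1 (by simpa using hM')
      obtain ⟨α, β, rfl⟩ := exists_eq_homog_add_idealDir T.finrank_g hX₀g hng hn hM'g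
      rw [map_add, map_smul, map_smul, hhom, hide, hb₀]
      simp [homog]) leg₅ hAB hρ (fun s M hM hsM => by
      obtain ⟨M', rfl, hM'⟩ := exists_vecMulVec_mem base plat hsM
      have hM0 : M' ≠ 0 := fun h => hM (by rw [h, map_zero])
      obtain ⟨X, r, rfl, -, h4⟩ := hmem (by rw [hplat'']; simp) hM0 hM'
      rw [map_smul, hhom] at hM ⊢
      have hr : r ≠ 0 := fun h => hM (by rw [h, zero_smul])
      refine ⟨by simpa [homog] using hr, ?_⟩
      simp [homog]
      linear_combination r ^ 2 * h4)
  exact nonempty_coordinatization_of_frame base plat hAB hc leg₁ leg₄ leg₅ hN₁ hN₂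

end Pentapod
end

theorem mainTheorem5 (P : Pentapod) (hP : P.InClassP) (hnp : ¬ P.IsPlanar)
    (hAR : ¬ P.AffineRelation) (T : P.TypeTwo) (hD : T.Duporcq) :
    -- the special coordinatization exists
    Nonempty P.Coordinatization ∧
    ∀ c : P.Coordinatization,
      -- the leg parameters form a one-parametric set, parametrized by `R₁`
      (∀ R₁ : ℂ, ∃! L : Pentapod.LegParams, L.R₁ = R₁ ∧ c.SelfMotionParams L) ∧
      -- any leg parameters belong to leg lengths of the pentapod, and vice versa
      (∀ L, ∃ R : Fin 5 → ℂ, c.Replaces R L) ∧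
      (∀ R, ∃ L : Pentapod.LegParams, c.Replaces R L) ∧
      ∀ (R : Fin 5 → ℂ) (L : Pentapod.LegParams), c.Replaces R L →
        -- for these parameters the configuration set is one-dimensional
        (c.SelfMotionParams L → Motion.configDim (c.pentapod.sphereConds R) = 1) ∧
        -- and there are no other self-motions
        ((L.R₁ ≠ 0 ∨ L.p₃ = star L.p₂) →
          1 ≤ Motion.configDim (c.pentapod.sphereConds R) → c.SelfMotionParams L) := by
  refine ⟨T.nonempty_coordinatization hP.not_archSing hD, fun c =>
    ⟨c.existsUnique_selfMotionParams, c.exists_legLengths, c.exists_legParams, fun R L h => ?_⟩⟩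
  rw [c.configDim_eq_of_replaces h]
  exact ⟨c.configDim_eq_one, c.selfMotionParams_of_one_le⟩
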